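/- Let $\Omega\subset\mathbb R^2$ be a bounded domain (a nonempty connected open set) of area $|\Omega|$, let $\beta>0$, and let $A=\frac{\beta}{2}(-x_2\,dx_1+x_1\,dx_2)$, with magnetic gradient $\nabla^A u=\nabla u-iuA$. Consider the magnetic Neumann eigenvalue problem in its weak form: find $\lambda\in\mathbb R$ and $0\neq u\in H^1(\Omega)$ (complex-valued) such that $$\int_\Omega\langle\nabla^A u,\overline{\nabla^A\phi}\rangle=\lambda\int_\Omega u\,\overline{\phi}\qquad\text{for all }\phi\in H^1(\Omega).$$ Assume that the spectrum of this problem, that is, of the associated self-adjoint operator on $L^2(\Omega)$, is discrete (it consists of isolated eigenvalues of finite multiplicity), and let $\lambda_1\le\lambda_2\le\cdots\nearrow+\infty$ be the eigenvalues, repeated according to multiplicity. Write $a_+=\max\{0,a\}$, let $[a]$ be the integer part (floor) of $a$, and set $\psi(a)=a-[a]-\frac12$ for $a\in\mathbb R$ and $$R(X)=\frac{\beta}{X}\,(X-[X])\,([X]-X+1)\qquad (X>0).$$ Then the following hold. 1. For all $z\ge 0$ the sum $R_1(z)=\sum_{j=1}^\infty(z-\lambda_j)_+$ converges and $$R_1(z)\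 \ge\ \frac{|\Omega|}{8\pi}z^2-\frac{\beta^2|\Omega|}{2\pi}\,\psi^2\!\left(\frac{z}{2\beta}+\frac12\right).$$ 2. For all integers $k\ge1$, $$\frac1k\sum_{j=1}^k\lambda_j\ \le\ \frac{2\pi k}{|\Omega|}+R\!\left(\frac{2\pi k}{\beta|\Omega|}\right).$$ 3. For all $X>0$, $\ 0\le R(X)\le\dfrac{\beta}{4X}$; and $R(X)=\beta(1-X)$ for $0<X\le1$. 4. For all integers $k$ with $1\le k\le\dfrac{\beta|\Omega|}{2\pi}$, $\ \dfrac1k\displaystyle\sum_{j=1}^k\lambda_j\le\beta$. -/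

import Mathlib

open MeasureTheory Filter Topology
open scoped ContDiff

namespace MagneticNeumann

/-- The Euclidean plane. -/
abbrev Plane : Type := EuclideanSpace ℝ (Fin 2)

/-- The complex Hilbert space `L²(Ω)`. -/
abbrev L2 (Ω : Set Plane) : Type := Lp ℂ 2 (volume.restrict Ω)

/-- The `j`-th partial derivative of a (smooth) real function on the plane. -/
noncomputable def partialDeriv (j : Fin 2) (η : Plane → ℝ) (x : Plane) : ℝ :=
  fderiv ℝ η x (EuclideanSpace.single j 1)

/-- `η` is a test function on `Ω`: smooth, with compact support contained in `Ω`. -/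
structure IsTestFunction (Ω : Set Plane) (η : Plane → ℝ) : Prop where
  contDiff : ContDiff ℝ ∞ η
  hasCompactSupport : HasCompactSupport η
  tsupport_subset : tsupport η ⊆ Ω

/-- `G = (G₁, G₂) ∈ L²(Ω)²` is the weak gradient of `u ∈ L²(Ω)`. Thus `u` belongs to the Sobolev
space `H¹(Ω)` exactly when it has a weak gradient in this sense. -/
def IsWeakGradient (Ω : Set Plane) (u : L2 Ω) (G : Fin 2 → L2 Ω) : Prop :=
  ∀ η : Plane → ℝ, IsTestFunction Ω η → ∀ j : Fin 2,
    ∫ x in Ω, (partialDeriv j η x : ℂ) * u x = -∫ x in Ω, (η x : ℂ) * G j x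

/-- The components of the standard potential `A = (β/2)(-x₂ dx₁ + x₁ dx₂)`. -/
noncomputable def standardPotential (β : ℝ) (x : Plane) : Fin 2 → ℝ :=
  ![-(β / 2) * x 1, (β / 2) * x 0]

/-- `u ∈ H¹(Ω)`, and `D ∈ L²(Ω)²` is its magnetic gradient `∇ᴬu = ∇u - i u A`. If `Ω` is bounded
then `A` is bounded on `Ω`, so every `u ∈ H¹(Ω)` has a magnetic gradient in this sense. -/
def IsMagneticGradient (Ω : Set Plane) (β : ℝ) (u : L2 Ω) (D : Fin 2 → L2 Ω) : Prop :=
  ∃ G : Fin 2 → L2 Ω, IsWeakGradient Ω u G ∧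
    ∀ j : Fin 2, ∀ᵐ x ∂(volume.restrict Ω),
      D j x = G j x - Complex.I * u x * (standardPotential β x j : ℂ)

/-- `u ∈ H¹(Ω)` is a weak solution of `Δ_A u = f` in `Ω`, `⟨∇ᴬu, N⟩ = 0` on `∂Ω`:
`∫_Ω ⟨∇ᴬu, conj ∇ᴬφ⟩ = ∫_Ω f conj φ` for all `φ ∈ H¹(Ω)`. (Mathlib's inner product is
conjugate-linear in the first argument.) Equivalently, `u` lies in the domain of the magnetic Neumann
Laplacian on `L²(Ω)`, and that operator maps `u` to `f`. -/
def IsNeumannSolution (Ω : Set Plane) (β : ℝ) (u f : L2 Ω) : Prop :=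
  ∃ D : Fin 2 → L2 Ω, IsMagneticGradient Ω β u D ∧
    ∀ (φ : L2 Ω) (Φ : Fin 2 → L2 Ω), IsMagneticGradient Ω β φ Φ →
      ∑ j : Fin 2, inner ℂ (Φ j) (D j) = inner ℂ φ f

/-! Linearity, needed to see that the eigenspaces are linear subspaces. -/

theorem IsTestFunction.memLp {Ω : Set Plane} {η : Plane → ℝ} (h : IsTestFunction Ω η) :
    MemLp (fun x => (η x : ℂ)) 2 (volume.restrict Ω) := by
  have hc : Continuous (fun x => (η x : ℂ)) :=
    Complex.continuous_ofReal.comp h.contDiff.continuous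
  have hs : HasCompactSupport (fun x => (η x : ℂ)) :=
    h.hasCompactSupport.comp_left (g := fun r : ℝ => (r : ℂ)) (by simp)
  exact (hc.memLp_of_hasCompactSupport hs).mono_measure Measure.restrict_le_self

theorem IsTestFunction.memLp_partialDeriv {Ω : Set Plane} {η : Plane → ℝ}
    (h : IsTestFunction Ω η) (j : Fin 2) :
    MemLp (fun x => (partialDeriv j η x : ℂ)) 2 (volume.restrict Ω) := by
  have hc : Continuous (fun x => (partialDeriv j η x : ℂ)) := by
    refine Complex.continuous_ofReal.comp ?_
    exact (h.contDiff.continuous_fderiv (by simp)).clm_apply continuous_const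
  have hs : HasCompactSupport (fun x => (partialDeriv j η x : ℂ)) :=
    (h.hasCompactSupport.fderiv (𝕜 := ℝ)).comp_left
      (g := fun L : Plane →L[ℝ] ℝ => ((L (EuclideanSpace.single j 1) : ℝ) : ℂ)) (by simp)
  exact (hc.memLp_of_hasCompactSupport hs).mono_measure Measure.restrict_le_self

theorem integral_mul_add {Ω : Set Plane} {m : Plane → ℂ} (hm : MemLp m 2 (volume.restrict Ω))
    (u v : L2 Ω) :
    ∫ x in Ω, m x * (u + v : L2 Ω) x = (∫ x in Ω, m x * u x) + ∫ x in Ω, m x * v x := by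
  have hu : Integrable (fun x => m x * u x) (volume.restrict Ω) :=
    hm.integrable_mul (Lp.memLp u)
  have hv : Integrable (fun x => m x * v x) (volume.restrict Ω) :=
    hm.integrable_mul (Lp.memLp v)
  rw [← integral_add hu hv]
  refine integral_congr_ae ?_
  filter_upwards [Lp.coeFn_add u v] with x hx
  rw [hx, Pi.add_apply, mul_add]

theorem integral_mul_smul {Ω : Set Plane} (m : Plane → ℂ) (c : ℂ) (u : L2 Ω) :
    ∫ x in Ω, m x * (c • u : L2 Ω) x = c * ∫ x in Ω, m x * u x := by
  rw [← integral_const_mul]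
  refine integral_congr_ae ?_
  filter_upwards [Lp.coeFn_smul c u] with x hx
  rw [hx, Pi.smul_apply, smul_eq_mul]
  ring

theorem IsMagneticGradient.add {Ω : Set Plane} {β : ℝ} {u v : L2 Ω} {D E : Fin 2 → L2 Ω}
    (hu : IsMagneticGradient Ω β u D) (hv : IsMagneticGradient Ω β v E) :
    IsMagneticGradient Ω β (u + v) (D + E) := by
  obtain ⟨G, hG, hD⟩ := hu
  obtain ⟨H, hH, hE⟩ := hv
  refine ⟨G + H, fun η hη j => ?_, fun j => ?_⟩
  · rw [integral_mul_add (hη.memLp_partialDeriv j), hG η hη j, hH η hη j, Pi.add_apply,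
      integral_mul_add hη.memLp]
    ring
  · filter_upwards [hD j, hE j, Lp.coeFn_add u v, Lp.coeFn_add (D j) (E j),
      Lp.coeFn_add (G j) (H j)] with x h1 h2 h3 h4 h5
    simp only [Pi.add_apply] at h3 h4 h5 ⊢
    rw [h4, h5, h3, h1, h2]
    ring

theorem IsMagneticGradient.smul {Ω : Set Plane} {β : ℝ} {u : L2 Ω} {D : Fin 2 → L2 Ω}
    (c : ℂ) (hu : IsMagneticGradient Ω β u D) :
    IsMagneticGradient Ω β (c • u) (c • D) := by
  obtain ⟨G, hG, hD⟩ := hu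
  refine ⟨c • G, fun η hη j => ?_, fun j => ?_⟩
  · rw [integral_mul_smul, hG η hη j, Pi.smul_apply, integral_mul_smul]
    ring
  · filter_upwards [hD j, Lp.coeFn_smul c u, Lp.coeFn_smul c (D j),
      Lp.coeFn_smul c (G j)] with x h1 h3 h4 h5
    simp only [Pi.smul_apply, smul_eq_mul] at h3 h4 h5 ⊢
    rw [h4, h5, h3, h1]
    ring

theorem IsNeumannSolution.add {Ω : Set Plane} {β : ℝ} {u v f g : L2 Ω}
    (hu : IsNeumannSolution Ω β u f) (hv : IsNeumannSolution Ω β v g) :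
    IsNeumannSolution Ω β (u + v) (f + g) := by
  obtain ⟨D, hD, hD'⟩ := hu
  obtain ⟨E, hE, hE'⟩ := hv
  refine ⟨D + E, hD.add hE, fun φ Φ h => ?_⟩
  simp only [Pi.add_apply, inner_add_right, Finset.sum_add_distrib]
  rw [hD' φ Φ h, hE' φ Φ h]

theorem IsNeumannSolution.smul {Ω : Set Plane} {β : ℝ} {u f : L2 Ω} (c : ℂ)
    (hu : IsNeumannSolution Ω β u f) : IsNeumannSolution Ω β (c • u) (c • f) := by
  obtain ⟨D, hD, hD'⟩ := hu
  refine ⟨c • D, hD.smul c, fun φ Φ h => ?_⟩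
  simp only [Pi.smul_apply, inner_smul_right, ← Finset.mul_sum]
  rw [hD' φ Φ h]

theorem IsNeumannSolution.zero (Ω : Set Plane) (β : ℝ) : IsNeumannSolution Ω β 0 0 := by
  have h0 : ∀ᵐ x ∂(volume.restrict Ω), (0 : L2 Ω) x = 0 :=
    (Lp.coeFn_zero ℂ 2 (volume.restrict Ω)).mono fun x hx => by rw [hx, Pi.zero_apply]
  refine ⟨fun _ => 0, ⟨fun _ => 0, fun η hη j => ?_, fun j => ?_⟩, fun φ Φ _ => ?_⟩
  · rw [integral_eq_zero_of_ae, integral_eq_zero_of_ae, neg_zero]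
    · filter_upwards [h0] with x hx
      rw [hx, mul_zero, Pi.zero_apply]
    · filter_upwards [h0] with x hx
      rw [hx, mul_zero, Pi.zero_apply]
  · filter_upwards [h0] with x hx
    rw [hx, mul_zero, zero_mul, sub_zero]
  · simp only [inner_zero_right, Finset.sum_const_zero]

/-- The space of weak solutions `u ∈ H¹(Ω)` of the magnetic Neumann eigenvalue problem
`∫_Ω ⟨∇ᴬu, conj ∇ᴬφ⟩ = μ ∫_Ω u conj φ` for all `φ ∈ H¹(Ω)`. -/
def eigenspace (Ω : Set Plane) (β : ℝ) (μ : ℂ) : Submodule ℂ (L2 Ω) where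
  carrier := {u | IsNeumannSolution Ω β u (μ • u)}
  add_mem' {u v} hu hv := by
    have h := IsNeumannSolution.add hu hv
    rwa [← smul_add] at h
  zero_mem' := by
    change IsNeumannSolution Ω β 0 (μ • 0)
    rw [smul_zero]
    exact IsNeumannSolution.zero Ω β
  smul_mem' c u hu := by
    have h := IsNeumannSolution.smul c hu
    rwa [smul_comm] at h

/-- The spectrum of the magnetic Neumann Laplacian `Δ_A` on `L²(Ω)`: the `μ ∈ ℂ` for which
`Δ_A - μ` is not a bijection from its domain onto `L²(Ω)`. -/
def magneticSpectrum (Ω : Set Plane) (β : ℝ) : Set ℂ :=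
  {μ | ¬ ∀ f : L2 Ω, ∃! u : L2 Ω, IsNeumannSolution Ω β u (μ • u + f)}

/-- The spectrum is discrete: it consists of isolated points, each of which is an eigenvalue of
finite multiplicity. -/
def HasDiscreteSpectrum (Ω : Set Plane) (β : ℝ) : Prop :=
  ∀ μ ∈ magneticSpectrum Ω β,
    (∃ U ∈ 𝓝 μ, U ∩ magneticSpectrum Ω β = {μ}) ∧
    eigenspace Ω β μ ≠ ⊥ ∧ FiniteDimensional ℂ (eigenspace Ω β μ)

/-- `lam 0 ≤ lam 1 ≤ ⋯ ↗ +∞` is the list of all the eigenvalues of the magnetic Neumann problem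
on `Ω`, each repeated according to its multiplicity; `lam j` is the eigenvalue `λ_{j+1}`. -/
structure IsEigenvalueSequence (Ω : Set Plane) (β : ℝ) (lam : ℕ → ℝ) : Prop where
  monotone : Monotone lam
  tendsto : Tendsto lam atTop atTop
  multiplicity : ∀ μ : ℝ,
    {j : ℕ | lam j = μ}.encard = (Module.finrank ℂ (eigenspace Ω β (μ : ℂ)) : ℕ∞)

/-- The first Riesz mean `R₁(z) = ∑_j (z - λ_j)_+`. -/
noncomputable def rieszMean (lam : ℕ → ℝ) (z : ℝ) : ℝ := ∑' j : ℕ, max 0 (z - lam j)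

/-- The fluctuation function `ψ(a) = a - [a] - 1/2`. -/
noncomputable def fluctuation (a : ℝ) : ℝ := a - (⌊a⌋ : ℝ) - 1 / 2

/-- The remainder `R(X) = (β / X) (X - [X]) ([X] - X + 1)`, for `X > 0`. -/
noncomputable def remainder (β X : ℝ) : ℝ :=
  β / X * (X - (⌊X⌋ : ℝ)) * ((⌊X⌋ : ℝ) - X + 1)

end MagneticNeumann

/-! The proof averages the variational principle over the generalized eigenfunctions of the Landau
Hamiltonian on the whole plane. Neumann conditions put no constraint on trial functions at the
boundary, so these can simply be restricted to Ω.

In the symmetric gauge they are `f_{n,k}(x) = exp(i(β x₀x₁/2 + k x₀)) h_n(x₁ + k/β)`, with `h_n` a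
normalized Hermite function and `k` real. For any `u` in the form domain, the eigenfunctions `e i`
with eigenvalue `μ i < z` satisfy `z‖u‖² - ‖∇ᴬu‖² ≤ ∑ (z - μ i) |⟨e i, u⟩|²`
(`exists_orthonormal_form_bound`). Take `u = f_{n,k}`, sum over `n < N` and integrate over `k`. On
the left, integrating in `k` first turns each point of Ω into the full one-dimensional integral, so
level `n` contributes `β|Ω|(z - β(2n+1))` (`integral_shifted_density`), for a total of `β|Ω|(Nz -
βN²)`. On the right, Bessel's inequality for the `f_{n,k}` bounds the coefficient of each `z - μ i`
by `2π` (`integral_landauCoeff_le`). Hence `R₁(z) ≥ (β|Ω|/2π)(Nz - βN²)` for every `N`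
(`le_rieszMean`).

The choice of `N` nearest to `z/(2β)` gives the Riesz mean bound. The bound on averages follows by
interpolating between two consecutive values of `N` at `z = λ_k`, with weights that make the terms
in `z` cancel.

The variational principle itself is derived from discreteness of the spectrum: with `ι` the
inclusion of the form domain in `L²(Ω)`, the operator `ι ι†` is the resolvent `(Δ_A + 1)⁻¹`, and its
part orthogonal to the `e i` has norm at most `(z+1)⁻¹`. -/

namespace MagneticNeumann

/-! ### Variational principle for an operator given by a closed form -/

section Abstract

theorem inner_self_eq_ofReal_norm_sq {E : Type*} [NormedAddCommGroup E] [InnerProductSpace ℂ E]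
    (x : E) : inner ℂ x x = ((‖x‖ ^ 2 : ℝ) : ℂ) := by
  rw [inner_self_eq_norm_sq_to_K]; simp

variable {H W I : Type*} [NormedAddCommGroup H] [InnerProductSpace ℂ H]
  [Fintype I]

/-- An isolated real point of the spectrum of a self-adjoint operator is an eigenvalue. -/
theorem exists_eigenvector_of_isolated [CompleteSpace H] {S : H →L[ℂ] H} (hS : IsSelfAdjoint S) {ν : ℝ}
    (hν : ν ∈ spectrum ℝ S) (hiso : ∃ U ∈ 𝓝 ν, U ∩ spectrum ℝ S ⊆ {ν}) :
    ∃ v : H, v ≠ 0 ∧ S v = (ν : ℂ) • v := by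
  classical
  obtain ⟨U, hU, hUS⟩ := hiso
  -- The indicator of an isolated point is continuous on the spectrum, so the functional calculus
  -- yields the spectral projection at `ν`; its nonzero values are eigenvectors.
  set f : ℝ → ℝ := fun x => if x = ν then 1 else 0 with hf_def
  have hf : ContinuousOn f (spectrum ℝ S) := by
    intro x hx
    by_cases hxν : x = ν
    · subst hxν
      refine (continuousWithinAt_const (b := (1 : ℝ))).congr_of_eventuallyEq ?_ (by simp [f])
      filter_upwards [mem_nhdsWithin_of_mem_nhds hU, self_mem_nhdsWithin] with y hy hy'
      have : y = x := hUS ⟨hy, hy'⟩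
      simp [f, this]
    · refine (continuousWithinAt_const (b := (0 : ℝ))).congr_of_eventuallyEq ?_ (by simp [f, hxν])
      filter_upwards [mem_nhdsWithin_of_mem_nhds (isOpen_ne.mem_nhds hxν)] with y hy
      simp [f, show y ≠ ν from hy]
  have hmul : S * cfc f S = ν • cfc f S := by
    have h1 : cfc (fun x => x * f x) S = S * cfc f S := by
      rw [cfc_mul (fun x => x) f S continuousOn_id hf, cfc_id' ℝ S]
    rw [← h1, ← cfc_smul ν f S hf]
    congr 1
    funext x
    by_cases hx : x = ν <;> simp [f, hx]
  have hne : cfc f S ≠ 0 := by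
    intro h0
    have h1 : (1 : ℝ) ∈ spectrum ℝ (cfc f S) := by
      rw [cfc_map_spectrum f S hS hf]
      exact ⟨ν, hν, by simp [f]⟩
    rw [h0, spectrum.mem_iff, sub_zero] at h1
    exact h1 (by simp)
  obtain ⟨w, hw⟩ : ∃ w, cfc f S w ≠ 0 := by
    by_contra! h
    exact hne (ContinuousLinearMap.ext h)
  refine ⟨cfc f S w, hw, ?_⟩
  have := congrArg (fun A : H →L[ℂ] H => A w) hmul
  simpa using this

/-- The orthogonal projection onto the span of a finite orthonormal family. -/
noncomputable def familyProj (e : I → H) : H →L[ℂ] H :=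
  ∑ i, (innerSL ℂ (e i)).smulRight (e i)

theorem familyProj_apply (e : I → H) (v : H) :
    familyProj e v = ∑ i, inner ℂ (e i) v • e i := by
  simp [familyProj]

theorem inner_familyProj {e : I → H} (he : Orthonormal ℂ e) (i : I) (v : H) :
    inner ℂ (e i) (familyProj e v) = inner ℂ (e i) v := by
  rw [familyProj_apply, he.inner_right_fintype]

theorem familyProj_idem {e : I → H} (he : Orthonormal ℂ e) (v : H) :
    familyProj e (familyProj e v) = familyProj e v := by
  rw [familyProj_apply e (familyProj e v), familyProj_apply e v]
  simp only [he.inner_right_fintype]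

theorem familyProj_symm (e : I → H) (v w : H) :
    inner ℂ (familyProj e v) w = inner ℂ v (familyProj e w) := by
  simp only [familyProj_apply, sum_inner, inner_sum, inner_smul_left, inner_smul_right,
    inner_conj_symm]
  exact Finset.sum_congr rfl fun i _ => mul_comm _ _

theorem familyProj_comm [CompleteSpace H] {T : H →L[ℂ] H} (hT : IsSelfAdjoint T) {e : I → H} {τ : I → ℝ}
    (hτ : ∀ i, T (e i) = (τ i : ℂ) • e i) (v : H) :
    familyProj e (T v) = T (familyProj e v) := by
  have hs := hT.isSymmetric
  simp only [familyProj_apply, map_sum, map_smul, hτ]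
  refine Finset.sum_congr rfl fun i _ => ?_
  have : inner ℂ (e i) (T v) = inner ℂ (T (e i)) v := (hs (e i) v).symm
  rw [this, hτ, inner_smul_left, smul_smul, Complex.conj_ofReal, mul_comm]

/-- The deflated operator is positive because `T` commutes with the projection, so its norm lies in
its spectrum. A norm above `c` would be an isolated point, hence an eigenvalue, with an eigenvector
orthogonal to every `e i`; this eigenvector belongs to `T` as well, contrary to `heig`. -/
theorem norm_deflated_le [CompleteSpace H] {T : H →L[ℂ] H} (hT : T.IsPositive) {e : I → H} (he : Orthonormal ℂ e)
    {τ : I → ℝ} (hτ : ∀ i, T (e i) = (τ i : ℂ) • e i) {c : ℝ} (hc : 0 < c)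
    (hiso : ∀ ν : ℝ, c < ν → (ν : ℂ) ∈ spectrum ℂ T →
      ∃ U ∈ 𝓝 ν, ∀ x ∈ U, (x : ℂ) ∈ spectrum ℂ T → x = ν)
    (heig : ∀ ν : ℝ, c < ν → ∀ v : H, T v = (ν : ℂ) • v → (∀ i, inner ℂ (e i) v = 0) → v = 0) :
    ‖T * (1 - familyProj e)‖ ≤ c := by
  by_contra! hlt
  set P := familyProj e with hP
  set S := T * (1 - P) with hS_def
  have hsa : IsSelfAdjoint T := hT.isSelfAdjoint
  have hcomm : ∀ v, P (T v) = T (P v) := familyProj_comm hsa hτ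
  have hidem : ∀ v, P (P v) = P v := familyProj_idem he
  have hSv : ∀ v, S v = T (v - P v) := fun v => by simp [S]
  have hinner : ∀ v w, inner ℂ (S v) w = inner ℂ (T (v - P v)) (w - P w) := by
    intro v w
    have h2 : inner ℂ (T (v - P v)) (P w) = 0 := by
      rw [← familyProj_symm, ← hP, hcomm, map_sub, hidem, sub_self, map_zero, inner_zero_left]
    rw [hSv, inner_sub_right, h2, sub_zero]
  have hSpos : S.IsPositive := by
    rw [ContinuousLinearMap.isPositive_iff_complex]
    intro v
    have := (ContinuousLinearMap.isPositive_iff_complex T).1 hT (v - P v)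
    rw [hinner]
    exact this
  have hSsa : IsSelfAdjoint S := hSpos.isSelfAdjoint
  have hnt : Nontrivial (H →L[ℂ] H) := by
    refine ⟨S, 0, fun h => ?_⟩
    rw [h, norm_zero] at hlt
    linarith
  set ν := ‖S‖
  have hν0 : 0 < ν := hc.trans hlt
  have hmem : ν ∈ spectrum ℝ S :=
    CStarAlgebra.norm_mem_spectrum_of_nonneg ((ContinuousLinearMap.nonneg_iff_isPositive S).2 hSpos)
  -- In blocks along `P` and `1 - P`, the operator `x - S` is `x` on the first and `x - T` on the
  -- second. A resolvent `R` of `T` therefore gives the inverse `x⁻¹ P + R (1 - P)`; the point `0`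
  -- has to be excluded.
  have hsub : ∀ x : ℝ, x ≠ 0 → x ∈ spectrum ℝ S → (x : ℂ) ∈ spectrum ℂ T := by
    intro x hx hxS hxT
    refine hxS ?_
    obtain ⟨R, hR1, hR2⟩ := isUnit_iff_exists.1 (spectrum.mem_resolventSet_iff.1 hxT)
    have hPP : P * P = P := ContinuousLinearMap.ext hidem
    have hPT : P * T = T * P := ContinuousLinearMap.ext hcomm
    set A := algebraMap ℂ (H →L[ℂ] H) (x : ℂ) - T with hA
    have hPA : P * A = A * P := by
      rw [hA, mul_sub, sub_mul, hPT, Algebra.commutes]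
    have hRP : R * P = P * R := by
      calc R * P = R * P * (A * R) := by rw [hR1, mul_one]
        _ = R * (P * A) * R := by noncomm_ring
        _ = (R * A) * P * R := by rw [hPA]; noncomm_ring
        _ = P * R := by rw [hR2, one_mul]
    have hB : algebraMap ℝ (H →L[ℂ] H) x - S = (x : ℂ) • P + A * (1 - P) := by
      rw [hA, hS_def, sub_mul, Algebra.algebraMap_eq_smul_one, Algebra.algebraMap_eq_smul_one,
        smul_mul_assoc, one_mul, smul_sub]
      have : (x : ℝ) • (1 : H →L[ℂ] H) = (x : ℂ) • (1 : H →L[ℂ] H) := by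
        ext v; simp
      rw [this]
      abel
    have hxc : (x : ℂ) ≠ 0 := by exact_mod_cast hx
    have hQ : P * (1 - P) = 0 := by rw [mul_sub, mul_one, hPP, sub_self]
    have hQ' : (1 - P) * P = 0 := by rw [sub_mul, one_mul, hPP, sub_self]
    have hQQ : (1 - P) * (1 - P) = 1 - P := by rw [mul_sub, mul_one, hQ', sub_zero]
    have hRQ : R * (1 - P) = (1 - P) * R := by rw [mul_sub, sub_mul, hRP, mul_one, one_mul]
    have hAQ : A * (1 - P) = (1 - P) * A := by rw [mul_sub A, sub_mul 1, hPA, mul_one, one_mul]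
    rw [spectrum.mem_resolventSet_iff, hB]
    refine isUnit_iff_exists.2 ⟨(x : ℂ)⁻¹ • P + R * (1 - P), ?_, ?_⟩
    · have h1 : P * (R * (1 - P)) = 0 := by rw [hRQ, ← mul_assoc, hQ, zero_mul]
      have h2 : A * (1 - P) * P = 0 := by rw [mul_assoc, hQ', mul_zero]
      have h3 : A * (1 - P) * (R * (1 - P)) = 1 - P := by
        rw [hRQ, mul_assoc, ← mul_assoc (1 - P) (1 - P), hQQ, ← hRQ, ← mul_assoc, hR1, one_mul]
      rw [add_mul, mul_add, mul_add, smul_mul_smul_comm, hPP, mul_inv_cancel₀ hxc, smul_mul_assoc,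
        h1, mul_smul_comm, h2, h3]
      simp
    · have h1 : P * (A * (1 - P)) = 0 := by rw [hAQ, ← mul_assoc, hQ, zero_mul]
      have h2 : R * (1 - P) * P = 0 := by rw [mul_assoc, hQ', mul_zero]
      have h3 : R * (1 - P) * (A * (1 - P)) = 1 - P := by
        rw [hAQ, mul_assoc, ← mul_assoc (1 - P) (1 - P), hQQ, ← hAQ, ← mul_assoc, hR2, one_mul]
      rw [add_mul, mul_add, mul_add, smul_mul_smul_comm, hPP, inv_mul_cancel₀ hxc, smul_mul_assoc,
        h1, mul_smul_comm, h2, h3]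
      simp
  obtain ⟨U, hU, hUT⟩ := hiso ν hlt (hsub ν hν0.ne' hmem)
  obtain ⟨v, hv0, hv⟩ := exists_eigenvector_of_isolated hSsa hmem
    ⟨U ∩ {0}ᶜ, inter_mem hU (isOpen_ne.mem_nhds hν0.ne'),
      fun x hx => hUT x hx.1.1 (hsub x hx.1.2 hx.2)⟩
  have hPv : P v = 0 := by
    have h1 : P (S v) = 0 := by
      rw [hSv, hcomm, map_sub, hidem, sub_self, map_zero]
    rw [hv, map_smul] at h1
    exact (smul_eq_zero.1 h1).resolve_left (by exact_mod_cast hν0.ne')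
  have hTv : T v = (ν : ℂ) • v := by rw [← hv, hSv, hPv, sub_zero]
  refine hv0 (heig ν hlt v hTv fun i => ?_)
  rw [← inner_familyProj he i v, ← hP, hPv, inner_zero_right]

/-- The variational lower bound for a closed form, given through the inclusion `ι` of its form
domain `W`: the operator with resolvent `ι ι†` is bounded below by `z` off the span of the
eigenvectors `e i`. -/
theorem form_lower_bound [CompleteSpace H] [NormedAddCommGroup W] [InnerProductSpace ℂ W]
    [CompleteSpace W] (ι : W →L[ℂ] H) {e : I → H} (he : Orthonormal ℂ e) {μ : I → ℝ} {z : ℝ}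
    (hz : -1 < z) (hμ0 : ∀ i, 0 < μ i + 1)
    (hμ : ∀ i, ι (ι.adjoint (e i)) = (((μ i + 1)⁻¹ : ℝ) : ℂ) • e i)
    (hiso : ∀ ν : ℝ, (z + 1)⁻¹ < ν → (ν : ℂ) ∈ spectrum ℂ (ι ∘L ι.adjoint) →
      ∃ U ∈ 𝓝 ν, ∀ x ∈ U, (x : ℂ) ∈ spectrum ℂ (ι ∘L ι.adjoint) → x = ν)
    (heig : ∀ ν : ℝ, (z + 1)⁻¹ < ν → ∀ v : H, ι (ι.adjoint v) = (ν : ℂ) • v →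
      (∀ i, inner ℂ (e i) v = 0) → v = 0) (w : W) :
    (z + 1) * ‖ι w‖ ^ 2 - ‖w‖ ^ 2 ≤ ∑ i, (z - μ i) * ‖inner ℂ (e i) (ι w)‖ ^ 2 := by
  have hz' : 0 < z + 1 := by linarith
  have hpos : (ι ∘L ι.adjoint).IsPositive := by
    have := (ContinuousLinearMap.isPositive_one (E := W) (𝕜 := ℂ)).conj_adjoint ι
    rwa [ContinuousLinearMap.one_def, ContinuousLinearMap.id_comp] at this
  have hnorm := norm_deflated_le hpos he (τ := fun i => (μ i + 1)⁻¹)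
    hμ (inv_pos.2 hz') hiso heig
  have hadj : ∀ v w, inner ℂ (ι.adjoint v) w = inner ℂ v (ι w) := fun v w =>
    ContinuousLinearMap.adjoint_inner_left ι w v
  -- With `h = ι w₂`, Cauchy–Schwarz in `W` gives `‖h‖² ≤ ‖ι† h‖ ‖w₂‖`, while `‖ι† h‖² = ⟨h, ι ι†
  -- h⟩` is controlled by the deflated norm.
  have hperp : ∀ w₂ : W, familyProj e (ι w₂) = 0 → (z + 1) * ‖ι w₂‖ ^ 2 ≤ ‖w₂‖ ^ 2 := by
    intro w₂ h2
    set h := ι w₂ with hh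
    have h3 : ‖ι (ι.adjoint h)‖ ≤ (z + 1)⁻¹ * ‖h‖ := by
      have h4 := ContinuousLinearMap.le_of_opNorm_le _ hnorm h
      simpa [h2] using h4
    have h5 : ‖ι.adjoint h‖ ^ 2 ≤ (z + 1)⁻¹ * ‖h‖ ^ 2 := by
      have h6 : ‖ι.adjoint h‖ ^ 2 = ‖inner ℂ h (ι (ι.adjoint h))‖ := by
        rw [← hadj, inner_self_eq_norm_sq_to_K]; simp
      rw [h6]
      refine (norm_inner_le_norm _ _).trans ?_
      nlinarith [norm_nonneg h]
    have h7 : ‖h‖ ^ 2 ≤ ‖ι.adjoint h‖ * ‖w₂‖ := by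
      have h8 : ‖h‖ ^ 2 = ‖inner ℂ (ι.adjoint h) w₂‖ := by
        rw [hadj, ← hh, inner_self_eq_norm_sq_to_K]; simp
      rw [h8]
      exact norm_inner_le_norm _ _
    by_cases h0 : ‖h‖ = 0
    · rw [h0]; simp
    · have hp : 0 < ‖h‖ ^ 2 := by positivity
      have h9 : (‖h‖ ^ 2) ^ 2 ≤ (z + 1)⁻¹ * ‖h‖ ^ 2 * ‖w₂‖ ^ 2 := by
        calc (‖h‖ ^ 2) ^ 2 ≤ (‖ι.adjoint h‖ * ‖w₂‖) ^ 2 := by gcongr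
          _ = ‖ι.adjoint h‖ ^ 2 * ‖w₂‖ ^ 2 := by ring
          _ ≤ _ := by gcongr
      have h10 : ‖h‖ ^ 2 ≤ (z + 1)⁻¹ * ‖w₂‖ ^ 2 := by
        refine le_of_mul_le_mul_right ?_ hp
        calc ‖h‖ ^ 2 * ‖h‖ ^ 2 = (‖h‖ ^ 2) ^ 2 := by ring
          _ ≤ _ := h9
          _ = _ := by ring
      calc (z + 1) * ‖h‖ ^ 2 ≤ (z + 1) * ((z + 1)⁻¹ * ‖w₂‖ ^ 2) := by gcongr
        _ = ‖w₂‖ ^ 2 := by field_simp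
  set g := ι w
  set a : I → ℂ := fun i => inner ℂ (e i) g with ha
  -- Since `(μ i + 1) • ι† (e i)` is the preimage of `e i` in the form domain, `w₁` lifts the
  -- projection of `g`. The splitting `w = w₁ + (w - w₁)` is orthogonal in `W`, and its image is
  -- orthogonal in `H`.
  set w₁ : W := ∑ i, (((μ i + 1 : ℝ) : ℂ) * a i) • ι.adjoint (e i) with hw₁
  have hιw₁ : ι w₁ = familyProj e g := by
    rw [hw₁, familyProj_apply, map_sum]
    refine Finset.sum_congr rfl fun i _ => ?_
    have h0 := (hμ0 i).ne'
    have h0' : ((μ i + 1 : ℝ) : ℂ) ≠ 0 := by exact_mod_cast h0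
    rw [map_smul, hμ, smul_smul, Complex.ofReal_inv]
    congr 1
    field_simp
    rfl
  have hw1 : ∀ y : W, inner ℂ w₁ y
      = ∑ i, ((μ i + 1 : ℝ) : ℂ) * (starRingEnd ℂ (a i) * inner ℂ (e i) (ι y)) := by
    intro y
    rw [hw₁, sum_inner]
    refine Finset.sum_congr rfl fun i _ => ?_
    rw [inner_smul_left, hadj, map_mul, Complex.conj_ofReal, mul_assoc]
  have horth : inner ℂ w₁ (w - w₁) = 0 := by
    rw [hw1]
    refine Finset.sum_eq_zero fun i _ => ?_
    rw [map_sub, hιw₁, inner_sub_right, inner_familyProj he, sub_self]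
    simp
  have hn1 : ‖w₁‖ ^ 2 = ∑ i, (μ i + 1) * ‖a i‖ ^ 2 := by
    have h1 := hw1 w₁
    rw [inner_self_eq_ofReal_norm_sq] at h1
    have h2 : ∀ i, starRingEnd ℂ (a i) * inner ℂ (e i) (ι w₁) = ((‖a i‖ ^ 2 : ℝ) : ℂ) := by
      intro i
      rw [hιw₁, inner_familyProj he]
      change starRingEnd ℂ (a i) * a i = _
      rw [Complex.conj_mul']
      simp
    simp only [h2] at h1
    exact_mod_cast h1
  have hsplit : ‖w‖ ^ 2 = ‖w₁‖ ^ 2 + ‖w - w₁‖ ^ 2 := by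
    have := norm_add_sq_eq_norm_sq_add_norm_sq_of_inner_eq_zero w₁ (w - w₁) horth
    rw [add_sub_cancel] at this
    nlinarith
  have hgsplit : ‖g‖ ^ 2 = (∑ i, ‖a i‖ ^ 2) + ‖ι (w - w₁)‖ ^ 2 := by
    have h0 : inner ℂ (familyProj e g) (g - familyProj e g) = 0 := by
      rw [familyProj_symm, map_sub, familyProj_idem he, sub_self, inner_zero_right]
    have := norm_add_sq_eq_norm_sq_add_norm_sq_of_inner_eq_zero _ _ h0
    rw [add_sub_cancel] at this
    have h1 : ‖familyProj e g‖ ^ 2 = ∑ i, ‖a i‖ ^ 2 := by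
      have h2 : inner ℂ (familyProj e g) (familyProj e g) = ∑ i, ((‖a i‖ ^ 2 : ℝ) : ℂ) := by
        rw [familyProj_apply, he.inner_sum]
        refine Finset.sum_congr rfl fun i _ => ?_
        change starRingEnd ℂ (a i) * a i = _
        rw [Complex.conj_mul']
        simp
      rw [inner_self_eq_ofReal_norm_sq] at h2
      exact_mod_cast h2
    rw [map_sub, hιw₁, ← h1]
    nlinarith
  have h2 := hperp (w - w₁) (by
    rw [map_sub, hιw₁, map_sub, familyProj_idem he, sub_self])
  have h3 : ∑ i, (z - μ i) * ‖a i‖ ^ 2 = (z + 1) * ∑ i, ‖a i‖ ^ 2 - ∑ i, (μ i + 1) * ‖a i‖ ^ 2 := by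
    rw [Finset.mul_sum, ← Finset.sum_sub_distrib]
    exact Finset.sum_congr rfl fun i _ => by ring
  change _ ≤ ∑ i, (z - μ i) * ‖a i‖ ^ 2
  rw [h3, hsplit, hgsplit, hn1]
  linarith

end Abstract

/-! ### The magnetic form domain and the resolvent of the Neumann Laplacian -/

section Form

variable {Ω : Set Plane} {β : ℝ}

theorem continuous_integral_mul {m : Plane → ℂ} (hm : MemLp m 2 (volume.restrict Ω)) :
    Continuous fun u : L2 Ω => ∫ x in Ω, m x * u x := by
  have h : (fun u : L2 Ω => ∫ x in Ω, m x * u x)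
      = fun u => inner ℂ (hm.star.toLp (star m)) u := by
    funext u
    rw [L2.inner_def]
    refine integral_congr_ae ?_
    filter_upwards [hm.star.coeFn_toLp] with x hx
    simp only [hx, RCLike.inner_apply, Pi.star_apply, RCLike.star_def, Complex.conj_conj]
    ring
  rw [h]
  fun_prop

theorem continuous_standardPotential (β : ℝ) (j : Fin 2) :
    Continuous fun x => standardPotential β x j := by
  fin_cases j <;> simp [standardPotential] <;> fun_prop

theorem exists_bound_of_continuous {f : Plane → ℝ} (hf : Continuous f)
    (hΩ : Bornology.IsBounded Ω) : ∃ C, ∀ x ∈ Ω, ‖f x‖ ≤ C := by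
  obtain ⟨C, hC⟩ := hΩ.isCompact_closure.exists_bound_of_continuousOn hf.continuousOn
  exact ⟨C, fun x hx => hC x (subset_closure hx)⟩

theorem memLp_continuous_mul {f : Plane → ℝ} (hf : Continuous f) (hm : MeasurableSet Ω)
    (hΩ : Bornology.IsBounded Ω) {u : Plane → ℂ} (hu : MemLp u 2 (volume.restrict Ω)) :
    MemLp (fun x => (f x : ℂ) * u x) 2 (volume.restrict Ω) := by
  obtain ⟨C, hC⟩ := exists_bound_of_continuous hf hΩ
  refine MemLp.of_le_mul (c := C) hu
    ((Complex.continuous_ofReal.comp hf).aestronglyMeasurable.mul hu.1) ?_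
  filter_upwards [ae_restrict_mem hm] with x hx
  rw [norm_mul, Complex.norm_real]
  gcongr
  exact hC x hx

/-- Eliminating the weak gradient `G` leaves, for each test function, an equation continuous in `(u,
D)`, which makes the form domain closed. Boundedness of Ω enters because `G` is recovered by adding
the product of `u` with the potential. -/
theorem isMagneticGradient_iff (hm : MeasurableSet Ω) (hΩ : Bornology.IsBounded Ω) (u : L2 Ω)
    (D : Fin 2 → L2 Ω) :
    IsMagneticGradient Ω β u D ↔ ∀ η : Plane → ℝ, IsTestFunction Ω η → ∀ j : Fin 2,
      (∫ x in Ω, (partialDeriv j η x : ℂ) * u x)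
        + (∫ x in Ω, ((standardPotential β x j : ℂ) * (Complex.I * η x)) * u x)
        + ∫ x in Ω, (η x : ℂ) * D j x = 0 := by
  have key : ∀ (G : Fin 2 → L2 Ω), (∀ j : Fin 2, ∀ᵐ x ∂(volume.restrict Ω),
      D j x = G j x - Complex.I * u x * (standardPotential β x j : ℂ)) →
      ∀ η : Plane → ℝ, IsTestFunction Ω η → ∀ j : Fin 2,
      ∫ x in Ω, (η x : ℂ) * G j x
        = (∫ x in Ω, ((standardPotential β x j : ℂ) * (Complex.I * η x)) * u x)
        + ∫ x in Ω, (η x : ℂ) * D j x := by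
    intro G hG η hη j
    have h1 : MemLp (fun x => (standardPotential β x j : ℂ) * (Complex.I * η x)) 2
        (volume.restrict Ω) :=
      memLp_continuous_mul (continuous_standardPotential β j) hm hΩ
        (hη.memLp.const_mul Complex.I)
    have h2 : Integrable (fun x => (standardPotential β x j : ℂ) * (Complex.I * η x) * u x)
        (volume.restrict Ω) := h1.integrable_mul (Lp.memLp u)
    have h3 : Integrable (fun x => (η x : ℂ) * D j x) (volume.restrict Ω) :=
      hη.memLp.integrable_mul (Lp.memLp (D j))
    rw [← integral_add h2 h3]
    refine integral_congr_ae ?_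
    filter_upwards [hG j] with x hx
    rw [hx]
    ring
  constructor
  · rintro ⟨G, hG, hD⟩ η hη j
    rw [hG η hη j, key G hD η hη j]
    ring
  · intro h
    have hA : ∀ j, MemLp (fun x => D j x + (standardPotential β x j : ℂ) * (Complex.I * u x)) 2
        (volume.restrict Ω) := fun j =>
      (Lp.memLp (D j)).add (memLp_continuous_mul (continuous_standardPotential β j) hm hΩ
        ((Lp.memLp u).const_mul Complex.I))
    have hG : ∀ j : Fin 2, ∀ᵐ x ∂(volume.restrict Ω),
        D j x = (hA j).toLp _ x - Complex.I * u x * (standardPotential β x j : ℂ) := fun j => by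
      filter_upwards [(hA j).coeFn_toLp] with x hx
      rw [hx]
      ring
    refine ⟨fun j => (hA j).toLp _, fun η hη j => ?_, hG⟩
    rw [key _ hG η hη j]
    linear_combination h η hη j

/-- The magnetic Sobolev space, as the space of all `(u, D)` with `D` the magnetic gradient
of `u`. -/
def formDomain (Ω : Set Plane) (β : ℝ) : Submodule ℂ (PiLp 2 fun _ : Fin 3 => L2 Ω) where
  carrier := {w | IsMagneticGradient Ω β (w 0) fun j => w j.succ}
  add_mem' hv hw := IsMagneticGradient.add hv hw
  zero_mem' := by
    obtain ⟨D, hD, -⟩ := IsNeumannSolution.zero Ω β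
    have := IsMagneticGradient.smul 0 hD
    rwa [zero_smul, zero_smul] at this
  smul_mem' c _ hw := IsMagneticGradient.smul c hw

theorem isClosed_formDomain (hm : MeasurableSet Ω) (hΩ : Bornology.IsBounded Ω) :
    IsClosed (formDomain Ω β : Set (PiLp 2 fun _ : Fin 3 => L2 Ω)) := by
  have h : (formDomain Ω β : Set (PiLp 2 fun _ : Fin 3 => L2 Ω))
      = ⋂ (η : Plane → ℝ) (_ : IsTestFunction Ω η) (j : Fin 2),
        {w | (∫ x in Ω, (partialDeriv j η x : ℂ) * w 0 x)
        + (∫ x in Ω, ((standardPotential β x j : ℂ) * (Complex.I * η x)) * w 0 x)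
        + ∫ x in Ω, (η x : ℂ) * w j.succ x = 0} := by
    ext w
    simp only [Set.mem_iInter]
    exact isMagneticGradient_iff hm hΩ (w 0) fun j => w j.succ
  rw [h]
  refine isClosed_iInter fun η => isClosed_iInter fun hη => isClosed_iInter fun j => ?_
  refine isClosed_eq ?_ continuous_const
  have hc : ∀ i : Fin 3, Continuous fun w : PiLp 2 fun _ : Fin 3 => L2 Ω => w i := fun i =>
    PiLp.continuous_apply 2 _ i
  refine ((continuous_integral_mul (hη.memLp_partialDeriv j)).comp (hc 0) |>.add
    ((continuous_integral_mul (memLp_continuous_mul (continuous_standardPotential β j) hm hΩ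
        (hη.memLp.const_mul Complex.I))).comp (hc 0))).add
    ((continuous_integral_mul hη.memLp).comp (hc j.succ))

/-- The inclusion of the form domain in `L²(Ω)`. -/
noncomputable def formInclusion (Ω : Set Plane) (β : ℝ) : formDomain Ω β →L[ℂ] L2 Ω :=
  (PiLp.proj 2 (fun _ : Fin 3 => L2 Ω) 0 : _ →L[ℂ] L2 Ω) ∘L (formDomain Ω β).subtypeL

theorem formInclusion_apply (w : formDomain Ω β) : formInclusion Ω β w = w.1 0 := rfl

/-- The element of the form domain given by a function and its magnetic gradient. -/
noncomputable def formDomainMk {u : L2 Ω} {D : Fin 2 → L2 Ω} (h : IsMagneticGradient Ω β u D) :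
    formDomain Ω β :=
  ⟨WithLp.toLp 2 (Fin.cons u D), h⟩

theorem formInclusion_mk {u : L2 Ω} {D : Fin 2 → L2 Ω} (h : IsMagneticGradient Ω β u D) :
    formInclusion Ω β (formDomainMk h) = u := rfl

theorem inner_formDomain (v w : formDomain Ω β) :
    inner ℂ v w = inner ℂ (v.1 0) (w.1 0) + ∑ j : Fin 2, inner ℂ (v.1 j.succ) (w.1 j.succ) := by
  rw [Submodule.coe_inner, PiLp.inner_apply, Fin.sum_univ_succ]

theorem norm_formDomainMk_sq {u : L2 Ω} {D : Fin 2 → L2 Ω} (h : IsMagneticGradient Ω β u D) :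
    ‖formDomainMk h‖ ^ 2 = ‖u‖ ^ 2 + ∑ j, ‖D j‖ ^ 2 := by
  have h1 := inner_formDomain (formDomainMk h) (formDomainMk h)
  have h2 : ∀ j : Fin 2, (formDomainMk h).1 j.succ = D j := fun _ => rfl
  have h3 : (formDomainMk h).1 0 = u := rfl
  simp only [h2, h3, inner_self_eq_ofReal_norm_sq] at h1
  exact_mod_cast h1

/-- Adding `⟨φ, u⟩` to both sides of the weak equation turns its left side into the inner product of
the form domain, so the equation says that `ι†(f + u)` is `u` together with its magnetic gradient.
-/
theorem isNeumannSolution_iff [CompleteSpace (formDomain Ω β)] (u f : L2 Ω) :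
    IsNeumannSolution Ω β u f ↔
      formInclusion Ω β ((formInclusion Ω β).adjoint (f + u)) = u := by
  set ι := formInclusion Ω β
  constructor
  · rintro ⟨D, hD, h⟩
    have : ι.adjoint (f + u) = formDomainMk hD := by
      refine ext_inner_left ℂ fun v => ?_
      rw [ContinuousLinearMap.adjoint_inner_right, inner_formDomain, inner_add_right,
        formInclusion_apply]
      have h1 := h (v.1 0) (fun j => v.1 j.succ) v.2
      rw [← h1, add_comm]
      rfl
    rw [this]
    rfl
  · intro h
    set w := ι.adjoint (f + u)
    have hw : w.1 0 = u := h
    have hw2 : IsMagneticGradient Ω β (w.1 0) fun j => w.1 j.succ := w.2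
    rw [hw] at hw2
    refine ⟨_, hw2, fun φ Φ hφ => ?_⟩
    have h1 : inner ℂ (formDomainMk hφ) w = inner ℂ φ (f + u) := by
      rw [ContinuousLinearMap.adjoint_inner_right]
      rfl
    rw [inner_formDomain, inner_add_right, hw] at h1
    change inner ℂ φ u + ∑ j, inner ℂ (Φ j) (w.1 j.succ) = _ at h1
    linear_combination h1

/-- Spectral mapping for the resolvent at `-1`: uniqueness for the datum `0` gives injectivity, and
solving with the datum `(κ + 1) • f` gives surjectivity. -/
theorem notMem_spectrum_of_notMem_magneticSpectrum [CompleteSpace (formDomain Ω β)] {κ : ℂ}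
    (hκ : κ + 1 ≠ 0) (h : κ ∉ magneticSpectrum Ω β) :
    (κ + 1)⁻¹ ∉ spectrum ℂ (formInclusion Ω β ∘L (formInclusion Ω β).adjoint) := by
  set T := formInclusion Ω β ∘L (formInclusion Ω β).adjoint
  have hsol : ∀ u f : L2 Ω, IsNeumannSolution Ω β u f ↔ T (f + u) = u := isNeumannSolution_iff
  have h' : ∀ f : L2 Ω, ∃! u : L2 Ω, IsNeumannSolution Ω β u (κ • u + f) := not_not.1 h
  rw [spectrum.notMem_iff, ContinuousLinearMap.isUnit_iff_bijective]
  have happ : ∀ u, (algebraMap ℂ (L2 Ω →L[ℂ] L2 Ω) (κ + 1)⁻¹ - T) u = (κ + 1)⁻¹ • u - T u := by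
    intro u
    simp [Algebra.algebraMap_eq_smul_one]
  constructor
  · rw [injective_iff_map_eq_zero]
    intro u hu
    rw [happ, sub_eq_zero] at hu
    have h1 : ∀ y, y = u ∨ y = 0 → IsNeumannSolution Ω β y (κ • y + 0) := by
      rintro y (rfl | rfl)
      · rw [hsol, add_zero]
        have : κ • y + y = (κ + 1) • y := by rw [add_smul, one_smul]
        rw [this, map_smul, ← hu, smul_smul, mul_inv_cancel₀ hκ, one_smul]
      · rw [hsol]
        simp
    exact (h' 0).unique (h1 u (Or.inl rfl)) (h1 0 (Or.inr rfl))
  · intro f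
    obtain ⟨w, hw, -⟩ := h' ((κ + 1) • f)
    rw [hsol] at hw
    have h2 : κ • w + (κ + 1) • f + w = (κ + 1) • (w + f) := by
      rw [smul_add, add_smul κ 1 w, one_smul]
      abel
    refine ⟨(κ + 1) • (w + f), ?_⟩
    rw [h2] at hw
    rw [happ, hw, smul_smul, inv_mul_cancel₀ hκ, one_smul, add_sub_cancel_left]

theorem mem_eigenspace_iff [CompleteSpace (formDomain Ω β)] {μ : ℂ} (hμ : μ + 1 ≠ 0) (v : L2 Ω) :
    v ∈ eigenspace Ω β μ ↔
      formInclusion Ω β ((formInclusion Ω β).adjoint v) = (μ + 1)⁻¹ • v := by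
  change IsNeumannSolution Ω β v (μ • v) ↔ _
  rw [isNeumannSolution_iff]
  have : μ • v + v = (μ + 1) • v := by rw [add_smul, one_smul]
  rw [this, map_smul, map_smul, eq_inv_smul_iff₀ hμ]

theorem nonneg_of_eigenspace_ne_bot {μ : ℝ} (h : eigenspace Ω β (μ : ℂ) ≠ ⊥) : 0 ≤ μ := by
  obtain ⟨v, hv, hv0⟩ := Submodule.exists_mem_ne_zero_of_ne_bot h
  obtain ⟨D, hD, h1⟩ := hv
  have h2 := h1 v D hD
  simp only [inner_smul_right, inner_self_eq_ofReal_norm_sq] at h2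
  have h3 : ∑ j, ‖D j‖ ^ 2 = μ * ‖v‖ ^ 2 := by exact_mod_cast h2
  have h4 : 0 ≤ μ * ‖v‖ ^ 2 := h3 ▸ Finset.sum_nonneg fun j _ => sq_nonneg _
  exact nonneg_of_mul_nonneg_left h4 (by positivity)

theorem mem_magneticSpectrum_of_eigenspace_ne_bot {μ : ℂ} (h : eigenspace Ω β μ ≠ ⊥) :
    μ ∈ magneticSpectrum Ω β := by
  obtain ⟨v, hv, hv0⟩ := Submodule.exists_mem_ne_zero_of_ne_bot h
  intro h1
  refine hv0 ((h1 0).unique (y₁ := v) (y₂ := 0) ?_ ?_)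
  · rw [add_zero]; exact hv
  · rw [add_zero]; exact (eigenspace Ω β μ).zero_mem

end Form

/-! ### Eigenfunctions below `z` and the Riesz mean -/

section EigenvalueSequence

variable {Ω : Set Plane} {β : ℝ} {lam : ℕ → ℝ}

theorem IsEigenvalueSequence.finite_lt (h : IsEigenvalueSequence Ω β lam) (z : ℝ) :
    {j | lam j < z}.Finite := by
  have h1 := h.tendsto.eventually_ge_atTop z
  rw [← Nat.cofinite_eq_atTop, eventually_cofinite] at h1
  simpa using h1

theorem IsEigenvalueSequence.hasFiniteSupport (h : IsEigenvalueSequence Ω β lam) (z : ℝ) :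
    ∀ j ∉ (h.finite_lt z).toFinset, max 0 (z - lam j) = 0 := by
  intro j hj
  have : z ≤ lam j := by simpa using hj
  exact max_eq_left (by linarith)

theorem IsEigenvalueSequence.rieszMean_eq (h : IsEigenvalueSequence Ω β lam) (z : ℝ) :
    rieszMean lam z = ∑ j ∈ (h.finite_lt z).toFinset, (z - lam j) := by
  rw [rieszMean, tsum_eq_sum (h.hasFiniteSupport z)]
  refine Finset.sum_congr rfl fun j hj => max_eq_right ?_
  have : lam j < z := by simpa using hj
  linarith

theorem IsEigenvalueSequence.finrank_pos (h : IsEigenvalueSequence Ω β lam) (j : ℕ) :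
    0 < Module.finrank ℂ (eigenspace Ω β (lam j : ℂ)) := by
  by_contra! h0
  have h1 := h.multiplicity (lam j)
  rw [Nat.le_zero.1 h0, Nat.cast_zero, Set.encard_eq_zero] at h1
  exact (Set.mem_empty_iff_false j).1 (h1 ▸ (rfl : lam j = lam j))

theorem ne_bot_of_finrank_pos {E : Type*} [AddCommGroup E] [Module ℂ E] {p : Submodule ℂ E}
    (h : 0 < Module.finrank ℂ p) : p ≠ ⊥ := by
  rintro rfl
  simp at h

theorem IsEigenvalueSequence.nonneg (h : IsEigenvalueSequence Ω β lam) (j : ℕ) : 0 ≤ lam j :=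
  nonneg_of_eigenspace_ne_bot (ne_bot_of_finrank_pos (h.finrank_pos j))

/-- An orthonormal family of eigenvectors that spans all eigenspaces with eigenvalue below `z`. -/
theorem exists_orthonormal_eigenbasis (hm : MeasurableSet Ω) (hΩ : Bornology.IsBounded Ω)
    (hdisc : HasDiscreteSpectrum Ω β) (hlam : IsEigenvalueSequence Ω β lam) (z : ℝ) :
    ∃ (I : Type) (_ : Fintype I) (e : I → L2 Ω) (μ : I → ℝ), Orthonormal ℂ e ∧
      (∀ i, μ i < z) ∧ (∀ i, 0 ≤ μ i) ∧ rieszMean lam z = ∑ i, (z - μ i) ∧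
      (∀ i, e i ∈ eigenspace Ω β (μ i : ℂ)) ∧
      ∀ s < z, ∀ v ∈ eigenspace Ω β ((s : ℝ) : ℂ), (∀ i, inner ℂ (e i) v = 0) → v = 0 := by
  classical
  have : CompleteSpace (formDomain Ω β) := (isClosed_formDomain hm hΩ).completeSpace_coe
  set ι := formInclusion Ω β
  set S : Finset ℝ := (hlam.finite_lt z).toFinset.image lam with hS
  have hfr : ∀ s : S, 0 < Module.finrank ℂ (eigenspace Ω β ((s : ℝ) : ℂ)) := by
    rintro ⟨s, hs⟩
    obtain ⟨j, -, rfl⟩ := Finset.mem_image.1 hs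
    exact hlam.finrank_pos j
  have hSz : ∀ s : S, (s : ℝ) < z := by
    rintro ⟨s, hs⟩
    obtain ⟨j, hj, rfl⟩ := Finset.mem_image.1 hs
    simpa using hj
  have hS0 : ∀ s : S, 0 ≤ (s : ℝ) := fun s =>
    nonneg_of_eigenspace_ne_bot (ne_bot_of_finrank_pos (hfr s))
  have hS1 : ∀ s : S, (((s : ℝ) : ℂ) + 1) ≠ 0 := fun s => by
    have := hS0 s
    exact_mod_cast (by linarith : (0 : ℝ) < s + 1).ne'
  have hb : ∀ s : S, Nonempty (OrthonormalBasis
      (Fin (Module.finrank ℂ (eigenspace Ω β ((s : ℝ) : ℂ)))) ℂ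
      (eigenspace Ω β ((s : ℝ) : ℂ))) := fun s => by
    have := Module.finite_of_finrank_pos (hfr s)
    exact ⟨stdOrthonormalBasis ℂ _⟩
  let b := fun s => (hb s).some
  let I := Σ s : S, Fin (Module.finrank ℂ (eigenspace Ω β ((s : ℝ) : ℂ)))
  let e : I → L2 Ω := fun i => (b i.1 i.2 : L2 Ω)
  let μ : I → ℝ := fun i => i.1
  have hTe : ∀ i, ι (ι.adjoint (e i)) = (((μ i + 1)⁻¹ : ℝ) : ℂ) • e i := fun i => by
    have := (mem_eigenspace_iff (hS1 i.1) (e i)).1 (b i.1 i.2).2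
    rw [this]
    push_cast
    rfl
  have he : Orthonormal ℂ e := by
    rw [orthonormal_iff_ite]
    rintro ⟨s, i⟩ ⟨t, j⟩
    by_cases hst : s = t
    · subst hst
      have := orthonormal_iff_ite.1 (b s).orthonormal i j
      rw [Submodule.coe_inner] at this
      change inner ℂ (b s i : L2 Ω) (b s j : L2 Ω) = _
      rw [this]
      by_cases hij : i = j
      · rw [if_pos hij, if_pos (by rw [hij])]
      · rw [if_neg hij, if_neg]
        exact fun h => hij (eq_of_heq (Sigma.mk.inj h).2)
    · rw [if_neg (fun h => hst (congrArg Sigma.fst h))]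
      -- Orthogonality across distinct eigenvalues comes from the symmetry of `ι ι†`, whose
      -- eigenvalues `(s + 1)⁻¹` are again distinct.
      have h1 : inner ℂ (ι (ι.adjoint (e ⟨s, i⟩))) (e ⟨t, j⟩)
          = inner ℂ (e ⟨s, i⟩) (ι (ι.adjoint (e ⟨t, j⟩))) := by
        rw [← ContinuousLinearMap.adjoint_inner_left, ← ContinuousLinearMap.adjoint_inner_right]
      rw [hTe, hTe, inner_smul_left, inner_smul_right, Complex.conj_ofReal] at h1
      have h2 : ((((s : ℝ) + 1)⁻¹ - ((t : ℝ) + 1)⁻¹ : ℝ) : ℂ) * inner ℂ (e ⟨s, i⟩) (e ⟨t, j⟩) = 0 := by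
        push_cast at h1 ⊢
        rw [sub_mul]
        exact sub_eq_zero.2 h1
      refine (mul_eq_zero.1 h2).resolve_left ?_
      rw [Complex.ofReal_eq_zero, sub_eq_zero, inv_inj, add_left_inj]
      exact fun h => hst (Subtype.ext h)
  refine ⟨I, inferInstance, e, μ, he, fun i => hSz i.1, fun i => hS0 i.1, ?_,
    fun i => (b i.1 i.2).2, fun s hsz v hvE hperp => ?_⟩
  · rw [hlam.rieszMean_eq, Fintype.sum_sigma]
    have h1 : ∀ s : S, ∑ i : Fin (Module.finrank ℂ (eigenspace Ω β ((s : ℝ) : ℂ))), (z - μ ⟨s, i⟩)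
        = (Module.finrank ℂ (eigenspace Ω β ((s : ℝ) : ℂ)) : ℝ) * (z - s) := fun s => by
      change ∑ _i : Fin _, (z - (s : ℝ)) = _
      rw [Finset.sum_const, Finset.card_univ, Fintype.card_fin, nsmul_eq_mul]
    simp only [h1]
    rw [Finset.sum_coe_sort S
        (fun s => (Module.finrank ℂ (eigenspace Ω β ((s : ℝ) : ℂ)) : ℝ) * (z - s)),
      ← Finset.sum_fiberwise_of_maps_to (g := lam) (t := S)
        (fun j hj => Finset.mem_image_of_mem lam hj)]
    refine Finset.sum_congr rfl fun s hs => ?_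
    -- Grouping the indices by their value, each fibre has as many elements as the eigenspace has
    -- dimensions.
    have h2 : ((hlam.finite_lt z).toFinset.filter fun j => lam j = s).card
        = Module.finrank ℂ (eigenspace Ω β ((s : ℝ) : ℂ)) := by
      have h3 := hlam.multiplicity s
      have h4 : {j | lam j = s} = (((hlam.finite_lt z).toFinset.filter fun j => lam j = s :
          Finset ℕ) : Set ℕ) := by
        ext j
        have := hSz ⟨s, hs⟩
        simp only [Finset.coe_filter, Set.Finite.mem_toFinset, Set.mem_ofPred_eq]
        exact ⟨fun h => ⟨h ▸ this, h⟩, fun h => h.2⟩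
      rw [h4, Set.encard_coe_eq_coe_finsetCard] at h3
      exact_mod_cast h3
    rw [← h2, ← nsmul_eq_mul, ← Finset.sum_const]
    refine Finset.sum_congr rfl fun j hj => ?_
    rw [(Finset.mem_filter.1 hj).2]
  · by_contra hv0
    have hne : eigenspace Ω β (s : ℂ) ≠ ⊥ := fun h => hv0 (by simpa [h] using hvE)
    have : FiniteDimensional ℂ (eigenspace Ω β (s : ℂ)) :=
      (hdisc _ (mem_magneticSpectrum_of_eigenspace_ne_bot hne)).2.2
    -- `finrank` is also `0` in infinite dimension; discreteness rules this out, so every eigenvalue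
    -- below `z` does occur in the sequence.
    have hfrs : Module.finrank ℂ (eigenspace Ω β (s : ℂ)) ≠ 0 := fun h =>
      hne (Submodule.finrank_eq_zero.1 h)
    obtain ⟨j, hj⟩ : {j | lam j = s}.Nonempty := by
      rw [← Set.encard_ne_zero, hlam.multiplicity]
      exact_mod_cast hfrs
    have hj' : lam j = s := hj
    have hsS : s ∈ S := Finset.mem_image.2 ⟨j, by simpa [hj'] using hsz, hj'⟩
    have h0 : (⟨v, hvE⟩ : eigenspace Ω β (s : ℂ)) = 0 := by
      refine InnerProductSpace.ext_inner_left_basis (b ⟨s, hsS⟩).toBasis fun i => ?_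
      rw [inner_zero_right, OrthonormalBasis.coe_toBasis]
      exact hperp ⟨⟨s, hsS⟩, i⟩
    exact hv0 (congrArg Subtype.val h0)

/-- The variational principle for the first Riesz mean: the eigenfunctions with eigenvalue below `z`
bound the form `z ‖u‖² - ‖∇ᴬu‖²` from above. -/
theorem exists_orthonormal_form_bound (hm : MeasurableSet Ω) (hΩ : Bornology.IsBounded Ω)
    (hdisc : HasDiscreteSpectrum Ω β) (hlam : IsEigenvalueSequence Ω β lam) {z : ℝ} (hz : -1 < z) :
    ∃ (I : Type) (_ : Fintype I) (e : I → L2 Ω) (μ : I → ℝ), Orthonormal ℂ e ∧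
      (∀ i, μ i < z) ∧ rieszMean lam z = ∑ i, (z - μ i) ∧
      ∀ (u : L2 Ω) (D : Fin 2 → L2 Ω), IsMagneticGradient Ω β u D →
        z * ‖u‖ ^ 2 - ∑ j, ‖D j‖ ^ 2 ≤ ∑ i, (z - μ i) * ‖inner ℂ (e i) u‖ ^ 2 := by
  have : CompleteSpace (formDomain Ω β) := (isClosed_formDomain hm hΩ).completeSpace_coe
  set ι := formInclusion Ω β
  obtain ⟨I, _, e, μ, he, hμz, hμnn, hsum, heμ, hspan⟩ :=
    exists_orthonormal_eigenbasis hm hΩ hdisc hlam z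
  have hTe : ∀ i, ι (ι.adjoint (e i)) = (((μ i + 1)⁻¹ : ℝ) : ℂ) • e i := fun i => by
    have h0 := hμnn i
    have := (mem_eigenspace_iff (by exact_mod_cast (by linarith : (0 : ℝ) < μ i + 1).ne')
      (e i)).1 (heμ i)
    rw [this]
    push_cast
    rfl
  refine ⟨I, inferInstance, e, μ, he, hμz, hsum, fun u D hD => ?_⟩
  have hz1 : 0 < z + 1 := by linarith
  have hμ0 : ∀ i, 0 < μ i + 1 := fun i => add_pos_of_nonneg_of_pos (hμnn i) one_pos
  have hmain := form_lower_bound ι he hz hμ0 hTe ?_ ?_ (formDomainMk hD)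
  · rw [formInclusion_mk, norm_formDomainMk_sq] at hmain
    linarith
  · intro ν hν hνT
    have hν0 : 0 < ν := (inv_pos.2 hz1).trans hν
    have hmem : ∀ x : ℝ, 0 < x → (x : ℂ) ∈ spectrum ℂ (ι ∘L ι.adjoint) →
        (x : ℂ)⁻¹ - 1 ∈ magneticSpectrum Ω β := by
      intro x hx hxT
      by_contra h
      have hx0 : (x : ℂ) ≠ 0 := by exact_mod_cast hx.ne'
      have := notMem_spectrum_of_notMem_magneticSpectrum (by simpa using hx0) h
      rw [sub_add_cancel, inv_inv] at this
      exact this hxT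
    -- Isolation is pulled back along the injective continuous map `x ↦ x⁻¹ - 1`, from the spectrum
    -- of the Laplacian to the positive spectrum of the resolvent.
    obtain ⟨⟨U, hU, hUs⟩, -⟩ := hdisc _ (hmem ν hν0 hνT)
    have hcont : ContinuousAt (fun x : ℝ => (x : ℂ)⁻¹ - 1) ν :=
      (Complex.continuous_ofReal.continuousAt.inv₀ (by exact_mod_cast hν0.ne')).sub
        continuousAt_const
    refine ⟨_, inter_mem (hcont hU) (Ioi_mem_nhds hν0), fun x hx hxT => ?_⟩
    have h1 : (x : ℂ)⁻¹ - 1 ∈ U ∩ magneticSpectrum Ω β := ⟨hx.1, hmem x hx.2 hxT⟩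
    rw [hUs, Set.mem_singleton_iff, sub_left_inj, inv_inj] at h1
    exact_mod_cast h1
  · intro ν hν v hv hperp
    have hν0 : 0 < ν := (inv_pos.2 hz1).trans hν
    set s : ℝ := ν⁻¹ - 1 with hs_def
    have hs1 : ((s : ℂ) + 1) = ((ν : ℂ))⁻¹ := by rw [hs_def]; push_cast; ring
    have hvE : v ∈ eigenspace Ω β (s : ℂ) := by
      rw [mem_eigenspace_iff, hs1, inv_inv]
      · exact hv
      · rw [hs1]
        exact inv_ne_zero (by exact_mod_cast hν0.ne')
    have hsz : s < z := by
      have := inv_lt_of_inv_lt₀ hz1 hν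
      linarith
    exact hspan s hsz v hvE hperp

end EigenvalueSequence

/-! ### Hermite functions and the harmonic oscillator -/

section Hermite

open Polynomial

/-- The Hermite polynomials for the weight `exp(-β t²)`. -/
noncomputable def hermitePoly (β : ℝ) : ℕ → ℝ[X]
  | 0 => 1
  | n + 1 => C (2 * β) * X * hermitePoly β n - derivative (hermitePoly β n)

theorem derivative_hermitePoly (β : ℝ) (n : ℕ) :
    derivative (hermitePoly β (n + 1)) = C (2 * β * (n + 1)) * hermitePoly β n := by
  induction n with
  | zero => simp [hermitePoly]
  | succ n ih =>
    have h : hermitePoly β (n + 2)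
        = C (2 * β) * X * hermitePoly β (n + 1) - derivative (hermitePoly β (n + 1)) := rfl
    have h' : hermitePoly β (n + 1)
        = C (2 * β) * X * hermitePoly β n - derivative (hermitePoly β n) := rfl
    rw [h, derivative_sub, ih, derivative_mul, derivative_mul, derivative_C, derivative_X, ih,
      derivative_mul, derivative_C]
    simp only [map_mul, map_add, map_natCast, map_one, Nat.cast_add, Nat.cast_one]
    rw [h']
    simp only [map_mul]
    ring

variable {β : ℝ}

theorem integrable_eval_mul_gaussian (hβ : 0 < β) (q : ℝ[X]) :
    Integrable fun t : ℝ => q.eval t * Real.exp (-β * t ^ 2) := by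
  induction q using Polynomial.induction_on' with
  | add p q hp hq =>
    simp only [eval_add, add_mul]
    exact hp.add hq
  | monomial n a =>
    have h := integrable_rpow_mul_exp_neg_mul_sq hβ (s := n)
      (lt_of_lt_of_le (by norm_num) n.cast_nonneg)
    simpa [mul_assoc] using h.const_mul a

/-- The Gaussian integral `∫ q(t) exp(-β t²) dt`. -/
noncomputable def gaussInt (β : ℝ) (q : ℝ[X]) : ℝ := ∫ t : ℝ, q.eval t * Real.exp (-β * t ^ 2)

theorem gaussInt_add (hβ : 0 < β) (p q : ℝ[X]) :
    gaussInt β (p + q) = gaussInt β p + gaussInt β q := by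
  simp only [gaussInt]
  rw [← integral_add (integrable_eval_mul_gaussian hβ p) (integrable_eval_mul_gaussian hβ q)]
  simp [add_mul]

theorem gaussInt_C_mul (a : ℝ) (q : ℝ[X]) : gaussInt β (C a * q) = a * gaussInt β q := by
  simp only [gaussInt]
  rw [← integral_const_mul]
  simp [mul_assoc]

theorem gaussInt_by_parts (hβ : 0 < β) (q : ℝ[X]) :
    gaussInt β (C (2 * β) * X * q) = gaussInt β (derivative q) := by
  have h := integral_eq_zero_of_hasDerivAt_of_integrable
    (f := fun t : ℝ => q.eval t * Real.exp (-β * t ^ 2))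
    (f' := fun t => (derivative q - C (2 * β) * X * q).eval t * Real.exp (-β * t ^ 2)) ?_
    (integrable_eval_mul_gaussian hβ _) (integrable_eval_mul_gaussian hβ _)
  · have h1 : gaussInt β (derivative q - C (2 * β) * X * q) = 0 := h
    have h2 := gaussInt_add hβ (derivative q - C (2 * β) * X * q) (C (2 * β) * X * q)
    rw [sub_add_cancel, h1, zero_add] at h2
    exact h2.symm
  · intro t
    have h1 : HasDerivAt (fun t : ℝ => Real.exp (-β * t ^ 2))
        (Real.exp (-β * t ^ 2) * (-β * (2 * t))) t := by
      simpa using ((hasDerivAt_pow 2 t).const_mul (-β)).exp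
    convert! (q.hasDerivAt t).mul h1 using 1
    simp
    ring

/-- The raising operator `2βt - d/dt` is the adjoint of `d/dt` for the Gaussian weight.
Orthogonality and the norms of the Hermite polynomials follow by induction. -/
theorem gaussInt_hermitePoly_succ_mul (hβ : 0 < β) (n : ℕ) (q : ℝ[X]) :
    gaussInt β (hermitePoly β (n + 1) * q) = gaussInt β (hermitePoly β n * derivative q) := by
  have h : hermitePoly β (n + 1) * q + derivative (hermitePoly β n) * q
      = C (2 * β) * X * (hermitePoly β n * q) := by
    simp only [hermitePoly]; ring
  have h1 := gaussInt_add hβ (hermitePoly β (n + 1) * q) (derivative (hermitePoly β n) * q)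
  rw [h, gaussInt_by_parts hβ, derivative_mul, gaussInt_add hβ] at h1
  linarith

theorem gaussInt_hermitePoly_mul_of_lt (hβ : 0 < β) {m n : ℕ} (h : n < m) :
    gaussInt β (hermitePoly β m * hermitePoly β n) = 0 := by
  induction n generalizing m with
  | zero =>
    obtain ⟨m, rfl⟩ := Nat.exists_eq_succ_of_ne_zero h.ne'
    rw [Nat.succ_eq_add_one, gaussInt_hermitePoly_succ_mul hβ]
    simp [hermitePoly, gaussInt]
  | succ n ih =>
    obtain ⟨m, rfl⟩ := Nat.exists_eq_succ_of_ne_zero (Nat.zero_lt_of_lt h).ne'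
    rw [Nat.succ_eq_add_one, gaussInt_hermitePoly_succ_mul hβ, derivative_hermitePoly,
      mul_left_comm, gaussInt_C_mul, ih (by omega), mul_zero]

theorem gaussInt_hermitePoly_mul_of_ne (hβ : 0 < β) {m n : ℕ} (h : m ≠ n) :
    gaussInt β (hermitePoly β m * hermitePoly β n) = 0 := by
  rcases lt_or_gt_of_ne h with h | h
  · rw [mul_comm]
    exact gaussInt_hermitePoly_mul_of_lt hβ h
  · exact gaussInt_hermitePoly_mul_of_lt hβ h

theorem gaussInt_hermitePoly_sq_succ (hβ : 0 < β) (n : ℕ) :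
    gaussInt β (hermitePoly β (n + 1) * hermitePoly β (n + 1))
      = 2 * β * (n + 1) * gaussInt β (hermitePoly β n * hermitePoly β n) := by
  rw [gaussInt_hermitePoly_succ_mul hβ, derivative_hermitePoly, mul_left_comm, gaussInt_C_mul]

theorem gaussInt_hermitePoly_sq_pos (hβ : 0 < β) (n : ℕ) :
    0 < gaussInt β (hermitePoly β n * hermitePoly β n) := by
  induction n with
  | zero =>
    have : gaussInt β (hermitePoly β 0 * hermitePoly β 0) = √(Real.pi / β) := by
      simpa [gaussInt, hermitePoly] using integral_gaussian β
    rw [this]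
    have := Real.pi_pos
    positivity
  | succ n ih =>
    rw [gaussInt_hermitePoly_sq_succ hβ]
    positivity

/-- The energy of the `n`-th Hermite function for the harmonic oscillator. -/
theorem gaussInt_hermitePoly_energy (hβ : 0 < β) (n : ℕ) :
    gaussInt β ((derivative (hermitePoly β n) - C β * X * hermitePoly β n) ^ 2
        + (C β * X * hermitePoly β n) ^ 2)
      = β * (2 * n + 1) * gaussInt β (hermitePoly β n * hermitePoly β n) := by
  have h2 : ∀ q : ℝ[X], gaussInt β (C (1 / 2) * q) = 1 / 2 * gaussInt β q := gaussInt_C_mul _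
  -- The energy density is half the sum of the squares of the raised and the lowered polynomial;
  -- their norms contribute `2β(n+1)` and `2βn` times that of `hermitePoly β n`.
  have h : (derivative (hermitePoly β n) - C β * X * hermitePoly β n) ^ 2
        + (C β * X * hermitePoly β n) ^ 2
      = C (1 / 2) * (hermitePoly β (n + 1) * hermitePoly β (n + 1)
        + derivative (hermitePoly β n) * derivative (hermitePoly β n)) := by
    have hC : (C (1 / 2) : ℝ[X]) * C 2 = 1 := by rw [← C_mul]; simp
    simp only [hermitePoly, map_mul]
    have e : ∀ a b c d : ℝ[X], c * d = 1 → d = 2 →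
        (a - b) ^ 2 + b ^ 2 = c * ((d * b - a) * (d * b - a) + a * a) := by
      intro a b c d h1 h2
      subst h2
      linear_combination (-2 * b ^ 2 + 2 * a * b - a ^ 2) * h1
    rw [e _ _ _ _ hC (map_ofNat C 2)]
    ring
  rw [h, h2, gaussInt_add hβ, gaussInt_hermitePoly_sq_succ hβ]
  cases n with
  | zero => simp [hermitePoly, gaussInt]; ring
  | succ n =>
    rw [derivative_hermitePoly, mul_mul_mul_comm, ← C_mul, gaussInt_C_mul,
      gaussInt_hermitePoly_sq_succ hβ]
    push_cast
    ring

/-- The normalized Hermite functions, the eigenfunctions of `-d²/dt² + β² t²`. -/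
noncomputable def hermiteFun (β : ℝ) (n : ℕ) (t : ℝ) : ℝ :=
  (√(gaussInt β (hermitePoly β n * hermitePoly β n)))⁻¹ *
    ((hermitePoly β n).eval t * Real.exp (-(β / 2) * t ^ 2))

/-- The derivatives of the normalized Hermite functions. -/
noncomputable def hermiteFunDeriv (β : ℝ) (n : ℕ) (t : ℝ) : ℝ :=
  (√(gaussInt β (hermitePoly β n * hermitePoly β n)))⁻¹ *
    ((derivative (hermitePoly β n) - C β * X * hermitePoly β n).eval t
      * Real.exp (-(β / 2) * t ^ 2))

theorem hasDerivAt_hermiteFun (β : ℝ) (n : ℕ) (t : ℝ) :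
    HasDerivAt (hermiteFun β n) (hermiteFunDeriv β n t) t := by
  have h1 : HasDerivAt (fun t : ℝ => Real.exp (-(β / 2) * t ^ 2))
      (Real.exp (-(β / 2) * t ^ 2) * (-(β / 2) * (2 * t))) t := by
    simpa using ((hasDerivAt_pow 2 t).const_mul (-(β / 2))).exp
  refine HasDerivAt.const_mul _ ?_
  convert! ((hermitePoly β n).hasDerivAt t).mul h1 using 1
  simp
  ring

theorem contDiff_hermiteFun (β : ℝ) (n : ℕ) : ContDiff ℝ ∞ (hermiteFun β n) := by
  refine contDiff_const.mul (ContDiff.mul ?_ ?_)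
  · simpa using (hermitePoly β n).contDiff_aeval (𝕜 := ℝ) ∞
  · exact (contDiff_const.mul (contDiff_id.pow 2)).exp

theorem continuous_hermiteFunDeriv (β : ℝ) (n : ℕ) : Continuous (hermiteFunDeriv β n) := by
  refine continuous_const.mul ((Polynomial.continuous _).mul ?_)
  fun_prop

theorem exp_half_mul_exp_half (β t : ℝ) :
    Real.exp (-(β / 2) * t ^ 2) * Real.exp (-(β / 2) * t ^ 2) = Real.exp (-β * t ^ 2) := by
  rw [← Real.exp_add]
  congr 1
  ring

theorem integrable_hermiteFun_mul (hβ : 0 < β) (m n : ℕ) :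
    Integrable fun t => hermiteFun β m t * hermiteFun β n t := by
  have h := (integrable_eval_mul_gaussian hβ (hermitePoly β m * hermitePoly β n)).const_mul
    ((√(gaussInt β (hermitePoly β m * hermitePoly β m)))⁻¹ *
      (√(gaussInt β (hermitePoly β n * hermitePoly β n)))⁻¹)
  refine h.congr (ae_of_all _ fun t => ?_)
  have e := exp_half_mul_exp_half β t
  simp only [hermiteFun, eval_mul]
  rw [← e]
  generalize Real.exp _ = E
  ring

theorem integral_hermiteFun_mul (hβ : 0 < β) (m n : ℕ) :
    ∫ t, hermiteFun β m t * hermiteFun β n t = if m = n then 1 else 0 := by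
  have h : ∀ t, hermiteFun β m t * hermiteFun β n t
      = ((√(gaussInt β (hermitePoly β m * hermitePoly β m)))⁻¹ *
      (√(gaussInt β (hermitePoly β n * hermitePoly β n)))⁻¹) *
      ((hermitePoly β m * hermitePoly β n).eval t * Real.exp (-β * t ^ 2)) := fun t => by
    have e := exp_half_mul_exp_half β t
    simp only [hermiteFun, eval_mul]
    rw [← e]
    generalize Real.exp _ = E
    ring
  simp only [h]
  rw [integral_const_mul]
  change _ * gaussInt β _ = _
  split_ifs with hmn
  · subst hmn
    have h0 := gaussInt_hermitePoly_sq_pos hβ m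
    rw [← mul_inv, Real.mul_self_sqrt h0.le, inv_mul_cancel₀ h0.ne']
  · rw [gaussInt_hermitePoly_mul_of_ne hβ hmn, mul_zero]

theorem hermite_energy_density (hβ : 0 < β) (n : ℕ) (t : ℝ) :
    hermiteFunDeriv β n t ^ 2 + (β * t * hermiteFun β n t) ^ 2
      = (gaussInt β (hermitePoly β n * hermitePoly β n))⁻¹ *
        (((derivative (hermitePoly β n) - C β * X * hermitePoly β n) ^ 2
        + (C β * X * hermitePoly β n) ^ 2).eval t * Real.exp (-β * t ^ 2)) := by
  have h0 := gaussInt_hermitePoly_sq_pos hβ n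
  have h1 : (gaussInt β (hermitePoly β n * hermitePoly β n))⁻¹
      = (√(gaussInt β (hermitePoly β n * hermitePoly β n)))⁻¹ ^ 2 := by
    rw [inv_pow, Real.sq_sqrt h0.le]
  rw [h1, hermiteFunDeriv, hermiteFun, ← exp_half_mul_exp_half β t]
  simp only [eval_add, eval_pow, eval_mul, eval_C, eval_X]
  generalize Real.exp _ = E
  ring

theorem integrable_hermite_energy (hβ : 0 < β) (n : ℕ) :
    Integrable fun t => hermiteFunDeriv β n t ^ 2 + (β * t * hermiteFun β n t) ^ 2 := by
  simp only [hermite_energy_density hβ]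
  exact (integrable_eval_mul_gaussian hβ _).const_mul _

theorem integral_hermite_energy (hβ : 0 < β) (n : ℕ) :
    ∫ t, (hermiteFunDeriv β n t ^ 2 + (β * t * hermiteFun β n t) ^ 2) = β * (2 * n + 1) := by
  simp only [hermite_energy_density hβ]
  rw [integral_const_mul]
  change _ * gaussInt β _ = _
  have h0 := gaussInt_hermitePoly_sq_pos hβ n
  rw [gaussInt_hermitePoly_energy hβ]
  field_simp

end Hermite

/-! ### Landau eigenfunctions as trial functions -/

section Trial

variable {Ω : Set Plane} {β : ℝ}

theorem memLp_of_continuous (hm : MeasurableSet Ω) (hΩ : Bornology.IsBounded Ω) {f : Plane → ℂ}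
    (hf : Continuous f) : MemLp f 2 (volume.restrict Ω) := by
  obtain ⟨C, hC⟩ := exists_bound_of_continuous hf.norm hΩ
  have : IsFiniteMeasure (volume.restrict Ω) :=
    isFiniteMeasure_restrict.2 hΩ.measure_lt_top.ne
  refine MemLp.of_bound hf.aestronglyMeasurable C ?_
  filter_upwards [ae_restrict_mem hm] with x hx
  simpa using hC x hx

theorem norm_toLp_sq {X : Type*} [MeasurableSpace X] {ν : Measure X} {f : X → ℂ}
    (hf : MemLp f 2 ν) : ‖hf.toLp f‖ ^ 2 = ∫ x, ‖f x‖ ^ 2 ∂ν := by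
  have h1 := inner_self_eq_ofReal_norm_sq (hf.toLp f)
  have h2 : inner ℂ (hf.toLp f) (hf.toLp f) = ((∫ x, ‖f x‖ ^ 2 ∂ν : ℝ) : ℂ) := by
    rw [L2.inner_def, ← integral_complex_ofReal]
    refine integral_congr_ae ?_
    filter_upwards [hf.coeFn_toLp] with x hx
    rw [hx, inner_self_eq_ofReal_norm_sq]
  rw [h1] at h2
  exact_mod_cast h2

theorem inner_toLp {X : Type*} [MeasurableSpace X] {ν : Measure X} {f : X → ℂ}
    (hf : MemLp f 2 ν) (u : Lp ℂ 2 ν) :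
    inner ℂ (hf.toLp f) u = ∫ x, starRingEnd ℂ (f x) * u x ∂ν := by
  rw [L2.inner_def]
  refine integral_congr_ae ?_
  filter_upwards [hf.coeFn_toLp] with x hx
  rw [hx, RCLike.inner_apply, mul_comm]

/-- The test function is compactly supported inside Ω, so integration by parts over the whole plane
leaves no boundary term and `f` may be arbitrary near the boundary. -/
theorem isWeakGradient_of_contDiff (hm : MeasurableSet Ω) (hΩ : Bornology.IsBounded Ω)
    {f : Plane → ℂ} (hf : ContDiff ℝ 1 f) {G : Fin 2 → Plane → ℂ}
    (hG : ∀ j x, fderiv ℝ f x (EuclideanSpace.single j 1) = G j x) (hGc : ∀ j, Continuous (G j)) :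
    IsWeakGradient Ω ((memLp_of_continuous hm hΩ hf.continuous).toLp f)
      fun j => (memLp_of_continuous hm hΩ (hGc j)).toLp (G j) := by
  intro η hη j
  have hη1 : ContDiff ℝ 1 η := hη.contDiff.of_le (by simp)
  have hd : ∀ x, fderiv ℝ (fun y => (η y : ℂ)) x (EuclideanSpace.single j 1)
      = (partialDeriv j η x : ℂ) := by
    intro x
    have h1 : HasFDerivAt (fun y => (η y : ℂ)) (Complex.ofRealCLM ∘L fderiv ℝ η x) x :=
      Complex.ofRealCLM.hasFDerivAt.comp x
        ((hη1.differentiable one_ne_zero).differentiableAt.hasFDerivAt)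
    rw [h1.fderiv]
    rfl
  have hcη : Continuous fun x => (η x : ℂ) := Complex.continuous_ofReal.comp hη1.continuous
  have hcd : Continuous fun x => (partialDeriv j η x : ℂ) :=
    Complex.continuous_ofReal.comp
      ((hη.contDiff.continuous_fderiv (by simp)).clm_apply continuous_const)
  have hsη : HasCompactSupport fun x => (η x : ℂ) :=
    hη.hasCompactSupport.comp_left (g := fun r : ℝ => (r : ℂ)) (by simp)
  have hsd : HasCompactSupport fun x => (partialDeriv j η x : ℂ) :=
    (hη.hasCompactSupport.fderiv (𝕜 := ℝ)).comp_left
      (g := fun L : Plane →L[ℝ] ℝ => ((L (EuclideanSpace.single j 1) : ℝ) : ℂ)) (by simp)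
  have hη0 : ∀ x, x ∉ Ω → η x = 0 := fun x hx =>
    image_eq_zero_of_notMem_tsupport fun h => hx (hη.tsupport_subset h)
  have hd0 : ∀ x, x ∉ Ω → partialDeriv j η x = 0 := fun x hx => by
    have : fderiv ℝ η x = 0 := by
      by_contra h
      exact hx (hη.tsupport_subset (support_fderiv_subset ℝ h))
    rw [partialDeriv, this]
    rfl
  have hibp := integral_mul_fderiv_eq_neg_fderiv_mul_of_integrable (μ := (volume : Measure Plane))
    (f := f) (g := fun x => (η x : ℂ)) (v := EuclideanSpace.single j 1) ?_ ?_ ?_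
    (fun x _ => (hf.differentiable one_ne_zero).differentiableAt)
    (fun x _ => Complex.ofRealCLM.differentiableAt.comp x
      (hη1.differentiable one_ne_zero).differentiableAt)
  · simp only [hd, hG] at hibp
    have h1 : ∫ x in Ω, (partialDeriv j η x : ℂ)
        * (memLp_of_continuous hm hΩ hf.continuous).toLp f x
        = ∫ x, f x * (partialDeriv j η x : ℂ) := by
      rw [← setIntegral_eq_integral_of_forall_compl_eq_zero (s := Ω) (μ := volume)
        (f := fun x => f x * (partialDeriv j η x : ℂ)) (fun x hx => by rw [hd0 x hx]; simp)]
      refine integral_congr_ae ?_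
      filter_upwards [(memLp_of_continuous hm hΩ hf.continuous).coeFn_toLp] with x hx
      rw [hx, mul_comm]
    have h2 : ∫ x in Ω, (η x : ℂ) * (memLp_of_continuous hm hΩ (hGc j)).toLp (G j) x
        = ∫ x, G j x * (η x : ℂ) := by
      rw [← setIntegral_eq_integral_of_forall_compl_eq_zero (s := Ω) (μ := volume)
        (f := fun x => G j x * (η x : ℂ)) (fun x hx => by rw [hη0 x hx]; simp)]
      refine integral_congr_ae ?_
      filter_upwards [(memLp_of_continuous hm hΩ (hGc j)).coeFn_toLp] with x hx
      rw [hx, mul_comm]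
    rw [h1, h2, hibp]
  · simp only [hG]
    exact ((hGc j).mul hcη).integrable_of_hasCompactSupport hsη.mul_left
  · simp only [hd]
    exact (hf.continuous.mul hcd).integrable_of_hasCompactSupport hsd.mul_left
  · exact (hf.continuous.mul hcη).integrable_of_hasCompactSupport hsη.mul_left

/-- The phase of the generalized Landau eigenfunctions. -/
noncomputable def landauPhase (β k : ℝ) (x : Plane) : ℂ :=
  Complex.exp (((β / 2 * x 0 * x 1 + k * x 0 : ℝ) : ℂ) * Complex.I)

/-- The generalized Landau eigenfunctions in the symmetric gauge. -/
noncomputable def landauFun (β : ℝ) (n : ℕ) (k : ℝ) (x : Plane) : ℂ :=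
  landauPhase β k x * (hermiteFun β n (x 1 + k / β) : ℂ)

/-- The magnetic gradient of the generalized Landau eigenfunctions. -/
noncomputable def landauGrad (β : ℝ) (n : ℕ) (k : ℝ) (j : Fin 2) (x : Plane) : ℂ :=
  ![landauPhase β k x * (Complex.I * ((β * (x 1 + k / β) * hermiteFun β n (x 1 + k / β) : ℝ) : ℂ)),
    landauPhase β k x * (hermiteFunDeriv β n (x 1 + k / β) : ℂ)] j

theorem norm_landauPhase (β k : ℝ) (x : Plane) : ‖landauPhase β k x‖ = 1 :=
  Complex.norm_exp_ofReal_mul_I _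

theorem contDiff_landauFun (β : ℝ) (n : ℕ) (k : ℝ) : ContDiff ℝ 1 (landauFun β n k) := by
  have h0 : ∀ j : Fin 2, ContDiff ℝ 1 fun x : Plane => x j := fun j => by fun_prop
  have h1 := h0 0
  have h2 := h0 1
  refine ContDiff.mul (ContDiff.cexp (ContDiff.mul ?_ contDiff_const)) ?_
  · exact Complex.ofRealCLM.contDiff.comp
      (((contDiff_const.mul h1).mul h2).add (contDiff_const.mul h1))
  · exact Complex.ofRealCLM.contDiff.comp (((contDiff_hermiteFun β n).of_le (by simp)).comp
      (h2.add contDiff_const))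

theorem continuous_landauPhase (β : ℝ) :
    Continuous fun p : ℝ × Plane => landauPhase β p.1 p.2 := by
  unfold landauPhase
  fun_prop

theorem continuous_landauFun (β : ℝ) (n : ℕ) :
    Continuous fun p : ℝ × Plane => landauFun β n p.1 p.2 := by
  have h := (contDiff_hermiteFun β n).continuous
  refine (continuous_landauPhase β).mul (Complex.continuous_ofReal.comp (h.comp ?_))
  fun_prop

theorem continuous_landauGrad (β : ℝ) (n : ℕ) (k : ℝ) (j : Fin 2) :
    Continuous (landauGrad β n k j) := by
  have h := (contDiff_hermiteFun β n).continuous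
  have h' := continuous_hermiteFunDeriv β n
  have hp : Continuous (landauPhase β k) :=
    (continuous_landauPhase β).comp (by fun_prop : Continuous fun x : Plane => (k, x))
  have h1 : Continuous fun x : Plane => x 1 + k / β := by fun_prop
  fin_cases j
  · exact hp.mul (continuous_const.mul (Complex.continuous_ofReal.comp
      ((continuous_const.mul h1).mul (h.comp h1))))
  · exact hp.mul (Complex.continuous_ofReal.comp (h'.comp h1))

/-- The phase has gradient `(β x₁/2 + k, β x₀/2)`. Subtracting the potential leaves `(β(x₁ + k/β),
0)`, so the phase passes to the Landau gauge and only the oscillator variable `x₁ + k/β` remains. -/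
theorem fderiv_landauFun (hβ : β ≠ 0) (n : ℕ) (k : ℝ) (j : Fin 2) (x : Plane) :
    fderiv ℝ (landauFun β n k) x (EuclideanSpace.single j 1)
      = landauGrad β n k j x
        + Complex.I * landauFun β n k x * (standardPotential β x j : ℂ) := by
  have hd : DifferentiableAt ℝ (landauFun β n k) x :=
    ((contDiff_landauFun β n k).differentiable one_ne_zero).differentiableAt
  rw [← hd.lineDeriv_eq_fderiv]
  refine HasLineDerivAt.lineDeriv ?_
  unfold HasLineDerivAt
  have hβc : (β : ℂ) ≠ 0 := by exact_mod_cast hβ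
  fin_cases j
  · have h1 : HasDerivAt (fun t : ℝ => β / 2 * (x 0 + t) * x 1 + k * (x 0 + t))
        (β / 2 * x 1 + k) 0 := by
      have h := (hasDerivAt_id (0 : ℝ)).const_add (x 0)
      simpa using ((h.const_mul (β / 2)).mul_const (x 1)).fun_add (h.const_mul k)
    have h2 := ((h1.ofReal_comp.mul_const Complex.I).cexp).mul_const
      ((hermiteFun β n (x 1 + k / β) : ℝ) : ℂ)
    convert! h2 using 1
    · funext t
      simp [landauFun, landauPhase]
    · simp only [landauGrad, landauFun, landauPhase, standardPotential]
      simp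
      field_simp
      ring
  · have h1 : HasDerivAt (fun t : ℝ => β / 2 * x 0 * (x 1 + t) + k * x 0)
        (β / 2 * x 0) 0 := by
      have h := (hasDerivAt_id (0 : ℝ)).const_add (x 1)
      simpa using (h.const_mul (β / 2 * x 0)).add_const (k * x 0)
    have h3 : HasDerivAt (fun t : ℝ => hermiteFun β n (x 1 + t + k / β))
        (hermiteFunDeriv β n (x 1 + k / β)) 0 := by
      have h := ((hasDerivAt_id (0 : ℝ)).const_add (x 1)).add_const (k / β)
      have h4 := hasDerivAt_hermiteFun β n (x 1 + 0 + k / β)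
      have h5 := h4.comp (0 : ℝ) h
      simpa [Function.comp_def] using h5
    have h2 := ((h1.ofReal_comp.mul_const Complex.I).cexp).mul h3.ofReal_comp
    convert! h2 using 1
    · funext t
      simp [landauFun, landauPhase]
    · simp only [landauGrad, landauFun, landauPhase, standardPotential]
      simp
      ring

theorem memLp_landauFun (hm : MeasurableSet Ω) (hΩ : Bornology.IsBounded Ω) (β : ℝ) (n : ℕ)
    (k : ℝ) : MemLp (landauFun β n k) 2 (volume.restrict Ω) :=
  memLp_of_continuous hm hΩ (contDiff_landauFun β n k).continuous

theorem memLp_landauGrad (hm : MeasurableSet Ω) (hΩ : Bornology.IsBounded Ω) (β : ℝ) (n : ℕ)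
    (k : ℝ) (j : Fin 2) : MemLp (landauGrad β n k j) 2 (volume.restrict Ω) :=
  memLp_of_continuous hm hΩ (continuous_landauGrad β n k j)

theorem isMagneticGradient_landauFun (hm : MeasurableSet Ω) (hΩ : Bornology.IsBounded Ω)
    (hβ : β ≠ 0) (n : ℕ) (k : ℝ) :
    IsMagneticGradient Ω β ((memLp_landauFun hm hΩ β n k).toLp _)
      fun j => (memLp_landauGrad hm hΩ β n k j).toLp _ := by
  have hc : ∀ j, Continuous fun x => landauGrad β n k j x
        + Complex.I * landauFun β n k x * (standardPotential β x j : ℂ) := fun j =>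
    (continuous_landauGrad β n k j).add ((continuous_const.mul
      (contDiff_landauFun β n k).continuous).mul
      (Complex.continuous_ofReal.comp (continuous_standardPotential β j)))
  refine ⟨_, isWeakGradient_of_contDiff hm hΩ (contDiff_landauFun β n k)
    (fderiv_landauFun hβ n k) hc, fun j => ?_⟩
  filter_upwards [(memLp_landauFun hm hΩ β n k).coeFn_toLp,
    (memLp_landauGrad hm hΩ β n k j).coeFn_toLp,
    (memLp_of_continuous hm hΩ (hc j)).coeFn_toLp] with x h1 h2 h3
  rw [h1, h2, h3]
  ring

theorem norm_landauFun_sq (β : ℝ) (n : ℕ) (k : ℝ) (x : Plane) :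
    ‖landauFun β n k x‖ ^ 2
      = hermiteFun β n (x 1 + k / β) * hermiteFun β n (x 1 + k / β) := by
  rw [landauFun, norm_mul, norm_landauPhase, one_mul, Complex.norm_real, Real.norm_eq_abs, sq_abs,
    sq]

theorem sum_norm_landauGrad_sq (β : ℝ) (n : ℕ) (k : ℝ) (x : Plane) :
    ∑ j, ‖landauGrad β n k j x‖ ^ 2 = hermiteFunDeriv β n (x 1 + k / β) ^ 2
      + (β * (x 1 + k / β) * hermiteFun β n (x 1 + k / β)) ^ 2 := by
  simp only [Fin.sum_univ_two, landauGrad, Matrix.cons_val_zero, Matrix.cons_val_one, norm_mul,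
    norm_landauPhase, one_mul, Complex.norm_I, Complex.norm_real, Real.norm_eq_abs]
  simp only [← abs_mul, sq_abs]
  ring

/-- The energy density `z h² - h'² - β² t² h²` of the `n`-th Hermite function. -/
noncomputable def hermiteDensity (β z : ℝ) (n : ℕ) (t : ℝ) : ℝ :=
  z * (hermiteFun β n t * hermiteFun β n t)
    - (hermiteFunDeriv β n t ^ 2 + (β * t * hermiteFun β n t) ^ 2)

theorem integrable_hermiteDensity (hβ : 0 < β) (z : ℝ) (n : ℕ) :
    Integrable (hermiteDensity β z n) :=
  ((integrable_hermiteFun_mul hβ n n).const_mul z).sub (integrable_hermite_energy hβ n)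

theorem integral_hermiteDensity (hβ : 0 < β) (z : ℝ) (n : ℕ) :
    ∫ t, hermiteDensity β z n t = z - β * (2 * n + 1) := by
  simp only [hermiteDensity]
  rw [integral_sub ((integrable_hermiteFun_mul hβ n n).const_mul z)
    (integrable_hermite_energy hβ n), integral_const_mul, integral_hermiteFun_mul hβ,
    integral_hermite_energy hβ, if_pos rfl, mul_one]

theorem continuous_hermiteDensity (β z : ℝ) (n : ℕ) : Continuous (hermiteDensity β z n) := by
  have h := (contDiff_hermiteFun β n).continuous
  have h' := continuous_hermiteFunDeriv β n
  unfold hermiteDensity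
  fun_prop

theorem landau_form_eq (hm : MeasurableSet Ω) (hΩ : Bornology.IsBounded Ω) (β z : ℝ) (n : ℕ)
    (k : ℝ) :
    z * ‖(memLp_landauFun hm hΩ β n k).toLp _‖ ^ 2
        - ∑ j, ‖(memLp_landauGrad hm hΩ β n k j).toLp _‖ ^ 2
      = ∫ x in Ω, hermiteDensity β z n (x 1 + k / β) := by
  have hi : ∀ {f : Plane → ℂ}, MemLp f 2 (volume.restrict Ω) →
      Integrable (fun x => ‖f x‖ ^ 2) (volume.restrict Ω) := fun hf =>
    (memLp_two_iff_integrable_sq_norm hf.1).1 hf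
  simp only [norm_toLp_sq]
  rw [← integral_finsetSum _ fun j _ => hi (memLp_landauGrad hm hΩ β n k j),
    ← integral_const_mul, ← integral_sub ((hi (memLp_landauFun hm hΩ β n k)).const_mul z)
      (integrable_finsetSum _ fun j _ => hi (memLp_landauGrad hm hΩ β n k j))]
  simp only [norm_landauFun_sq, sum_norm_landauGrad_sq]
  rfl

/-- For fixed `x`, the substitution `t = x₁ + k/β` makes the integral in `k` equal to `β` times an
integral over the line that does not depend on `x`; Ω has finite measure. -/
theorem integrable_shifted_density (hβ : 0 < β) (hΩ : Bornology.IsBounded Ω) (z : ℝ) (n : ℕ) :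
    Integrable (fun p : ℝ × Plane => hermiteDensity β z n (p.2 1 + p.1 / β))
      ((volume : Measure ℝ).prod (volume.restrict Ω)) := by
  have : IsFiniteMeasure (volume.restrict Ω) :=
    isFiniteMeasure_restrict.2 hΩ.measure_lt_top.ne
  have hshift : ∀ {f : ℝ → ℝ} (a : ℝ), Integrable f → Integrable fun k => f (a + k / β) :=
    fun a hf => (hf.comp_add_left a).comp_div hβ.ne'
  rw [integrable_prod_iff']
  · refine ⟨ae_of_all _ fun x => hshift (x 1) (integrable_hermiteDensity hβ z n), ?_⟩
    have : ∀ x : Plane, ∫ k, ‖hermiteDensity β z n (x 1 + k / β)‖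
        = β * ∫ t, ‖hermiteDensity β z n t‖ := fun x => by
      rw [Measure.integral_comp_div (fun k => ‖hermiteDensity β z n (x 1 + k)‖) β,
        integral_add_left_eq_self (fun k => ‖hermiteDensity β z n k‖), abs_of_pos hβ, smul_eq_mul]
    simp only [this]
    exact integrable_const _
  · have h := continuous_hermiteDensity β z n
    exact (h.comp (by fun_prop : Continuous fun p : ℝ × Plane =>
      p.2 1 + p.1 / β)).aestronglyMeasurable

theorem integral_shifted_density (hβ : 0 < β) (hΩ : Bornology.IsBounded Ω) (z : ℝ) (n : ℕ) :
    ∫ k : ℝ, ∫ x in Ω, hermiteDensity β z n (x 1 + k / β)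
      = (volume Ω).toReal * (β * (z - β * (2 * n + 1))) := by
  rw [integral_integral_swap (integrable_shifted_density hβ hΩ z n)]
  have : ∀ x : Plane, ∫ k, hermiteDensity β z n (x 1 + k / β)
      = β * (z - β * (2 * n + 1)) := fun x => by
    rw [Measure.integral_comp_div (fun k => hermiteDensity β z n (x 1 + k)) β,
      integral_add_left_eq_self (fun k => hermiteDensity β z n k), abs_of_pos hβ, smul_eq_mul,
      integral_hermiteDensity hβ]
  simp only [this]
  rw [integral_const, smul_eq_mul]
  simp [Measure.real]

end Trial

/-! ### Bessel's inequality for the Landau eigenfunctions -/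

section Bessel

variable {Ω : Set Plane} {β : ℝ}

/-- A vertical strip of width `L`. -/
def strip (L : ℝ) : Set Plane := {x | x 0 ∈ Set.Ioc (-(L / 2)) (L / 2)}

/-- The coordinates of the plane, as a measurable equivalence. -/
noncomputable def planeCoord : Plane ≃ᵐ ℝ × ℝ :=
  (MeasurableEquiv.toLp 2 (Fin 2 → ℝ)).symm.trans MeasurableEquiv.finTwoArrow

theorem planeCoord_apply (x : Plane) : planeCoord x = (x 0, x 1) := rfl

theorem measurePreserving_planeCoord : MeasurePreserving planeCoord volume volume :=
  (volume_preserving_finTwoArrow ℝ).comp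
    (EuclideanSpace.volume_preserving_symm_measurableEquiv_toLp (Fin 2))

theorem measurePreserving_planeCoord_strip (L : ℝ) :
    MeasurePreserving planeCoord (volume.restrict (strip L))
      ((volume.restrict (Set.Ioc (-(L / 2)) (L / 2))).prod volume) := by
  have h := measurePreserving_planeCoord.restrict_preimage
    (s := Set.Ioc (-(L / 2)) (L / 2) ×ˢ Set.univ) (measurableSet_Ioc.prod MeasurableSet.univ)
  have h1 : planeCoord ⁻¹' (Set.Ioc (-(L / 2)) (L / 2) ×ˢ Set.univ) = strip L := by
    ext x
    simp [planeCoord_apply, strip]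
  rwa [h1, Measure.volume_eq_prod, ← Measure.prod_restrict, Measure.restrict_univ] at h

theorem integral_strip_mul (L : ℝ) (f g : ℝ → ℂ) :
    ∫ x in strip L, f (x 0) * g (x 1)
      = (∫ t in Set.Ioc (-(L / 2)) (L / 2), f t) * ∫ t, g t := by
  rw [← integral_prod_mul,
    ← (measurePreserving_planeCoord_strip L).integral_comp planeCoord.measurableEmbedding]
  rfl

theorem memLp_landauFun_strip (hβ : 0 < β) (L : ℝ) (n : ℕ) (k : ℝ) :
    MemLp (landauFun β n k) 2 (volume.restrict (strip L)) := by
  rw [memLp_two_iff_integrable_sq_norm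
    (contDiff_landauFun β n k).continuous.aestronglyMeasurable]
  simp only [norm_landauFun_sq]
  have h1 : Integrable (fun t => hermiteFun β n (t + k / β) * hermiteFun β n (t + k / β)) :=
    (integrable_hermiteFun_mul hβ n n).comp_add_right (k / β)
  have h2 := (integrable_const (μ := volume.restrict (Set.Ioc (-(L / 2)) (L / 2)))
    (1 : ℝ)).mul_prod h1
  have h3 := ((measurePreserving_planeCoord_strip L).integrable_comp_emb
    planeCoord.measurableEmbedding).2 h2
  simpa [Function.comp_def, planeCoord_apply] using h3

theorem conj_landauFun_mul (β : ℝ) (m n : ℕ) (k l : ℝ) (x : Plane) :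
    starRingEnd ℂ (landauFun β m k x) * landauFun β n l x
      = Complex.exp ((((l - k : ℝ) : ℂ) * Complex.I) * (x 0 : ℂ))
        * ((hermiteFun β m (x 1 + k / β) * hermiteFun β n (x 1 + l / β) : ℝ) : ℂ) := by
  have h : starRingEnd ℂ (landauPhase β k x) * landauPhase β l x
      = Complex.exp ((((l - k : ℝ) : ℂ) * Complex.I) * (x 0 : ℂ)) := by
    rw [landauPhase, landauPhase, ← Complex.exp_conj, ← Complex.exp_add]
    congr 1
    simp only [map_mul, Complex.conj_ofReal, Complex.conj_I]
    push_cast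
    ring
  rw [landauFun, landauFun, map_mul, Complex.conj_ofReal, ← h]
  push_cast
  ring

theorem integral_exp_period {L : ℝ} (hL : 0 < L) {m : ℤ} (hm : m ≠ 0) :
    ∫ t in Set.Ioc (-(L / 2)) (L / 2),
      Complex.exp ((((m • (2 * Real.pi / L) : ℝ) : ℂ) * Complex.I) * (t : ℂ)) = 0 := by
  have hLc : (L : ℂ) ≠ 0 := by exact_mod_cast hL.ne'
  have hc : (((m • (2 * Real.pi / L) : ℝ) : ℂ) * Complex.I) ≠ 0 := by
    refine mul_ne_zero ?_ Complex.I_ne_zero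
    have := Real.pi_pos
    rw [zsmul_eq_mul, Complex.ofReal_ne_zero]
    positivity
  rw [← intervalIntegral.integral_of_le (by linarith), integral_exp_mul_complex hc,
    div_eq_zero_iff]
  left
  have h : (((m • (2 * Real.pi / L) : ℝ) : ℂ) * Complex.I) * ((L / 2 : ℝ) : ℂ)
      = (((m • (2 * Real.pi / L) : ℝ) : ℂ) * Complex.I) * ((-(L / 2) : ℝ) : ℂ)
        + m * (2 * Real.pi * Complex.I) := by
    push_cast [zsmul_eq_mul]
    field_simp
    ring
  rw [h, Complex.exp_add, Complex.exp_int_mul_two_pi_mul_I, mul_one, sub_self]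

/-- The normalized Landau functions of the strip of width `L`, with quasi-momenta in a coset of
`(2π/L)ℤ`. -/
noncomputable def stripFun (hβ : 0 < β) (L k : ℝ)
    (p : AddSubgroup.zmultiples (2 * Real.pi / L) × ℕ) : Lp ℂ 2 (volume.restrict (strip L)) :=
  (((√L)⁻¹ : ℝ) : ℂ) • (memLp_landauFun_strip hβ L p.2 (-(p.1 : ℝ) + k)).toLp _

/-- Distinct quasi-momenta differ by a nonzero multiple of `2π/L`, so the exponential in `x₀`
integrates to zero over the width. For equal quasi-momenta the oscillator variables agree, and
orthonormality of the Hermite functions applies. -/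
theorem orthonormal_stripFun (hβ : 0 < β) {L : ℝ} (hL : 0 < L) (k : ℝ) :
    Orthonormal ℂ (stripFun hβ L k) := by
  classical
  rw [orthonormal_iff_ite]
  rintro ⟨g, m⟩ ⟨g', n⟩
  have h1 : inner ℂ ((memLp_landauFun_strip hβ L m (-(g : ℝ) + k)).toLp _)
      ((memLp_landauFun_strip hβ L n (-(g' : ℝ) + k)).toLp _)
      = (∫ t in Set.Ioc (-(L / 2)) (L / 2),
          Complex.exp ((((g - g' : ℝ) : ℂ) * Complex.I) * (t : ℂ)))
        * ((∫ t, hermiteFun β m (t + (-(g : ℝ) + k) / β)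
          * hermiteFun β n (t + (-(g' : ℝ) + k) / β) : ℝ) : ℂ) := by
    rw [inner_toLp, ← integral_complex_ofReal, ← integral_strip_mul]
    refine integral_congr_ae ?_
    filter_upwards [(memLp_landauFun_strip hβ L n (-(g' : ℝ) + k)).coeFn_toLp] with x hx
    rw [hx, conj_landauFun_mul]
    congr 5
    ring
  have hs : ((√L)⁻¹ : ℝ) * ((√L)⁻¹ : ℝ) * L = 1 := by
    rw [← mul_inv, Real.mul_self_sqrt hL.le, inv_mul_cancel₀ hL.ne']
  simp only [stripFun]
  rw [inner_smul_left, inner_smul_right, h1, Complex.conj_ofReal]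
  by_cases hg : g = g'
  · subst hg
    have h2 : ∫ t, hermiteFun β m (t + (-(g : ℝ) + k) / β)
          * hermiteFun β n (t + (-(g : ℝ) + k) / β) = if m = n then 1 else 0 := by
      rw [integral_add_right_eq_self (fun t => hermiteFun β m t * hermiteFun β n t),
        integral_hermiteFun_mul hβ]
    have h3 : ∫ t in Set.Ioc (-(L / 2)) (L / 2),
        Complex.exp (((((g : ℝ) - g : ℝ) : ℂ) * Complex.I) * (t : ℂ)) = (L : ℂ) := by
      simp [Measure.real, hL.le]
    rw [h2, h3]
    by_cases hmn : m = n
    · subst hmn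
      rw [if_pos rfl, if_pos rfl]
      have := congrArg (fun r : ℝ => (r : ℂ)) hs
      push_cast at this ⊢
      linear_combination this
    · rw [if_neg hmn, if_neg (by simpa using hmn)]
      simp
  · have h2 : ∫ t in Set.Ioc (-(L / 2)) (L / 2),
        Complex.exp (((((g : ℝ) - g' : ℝ) : ℂ) * Complex.I) * (t : ℂ)) = 0 := by
      obtain ⟨a, ha⟩ := AddSubgroup.mem_zmultiples_iff.1 (g - g').2
      have ha' : ((g : ℝ) - g' : ℝ) = a • (2 * Real.pi / L) := by
        rw [ha]; rfl
      rw [ha']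
      refine integral_exp_period hL fun h0 => hg ?_
      rw [h0, zero_smul] at ha
      exact sub_eq_zero.1 (Subtype.ext ha.symm)
    rw [h2, if_neg (by simp [hg])]
    simp

/-- The coefficients of `u` with respect to the generalized Landau eigenfunctions. -/
noncomputable def landauCoeff (β : ℝ) (u : L2 Ω) (n : ℕ) (k : ℝ) : ℂ :=
  ∫ x in Ω, starRingEnd ℂ (landauFun β n k x) * u x

theorem stronglyMeasurable_landauCoeff (β : ℝ) (u : L2 Ω) (n : ℕ) :
    StronglyMeasurable (landauCoeff β u n) := by
  refine StronglyMeasurable.integral_prod_right (ν := volume.restrict Ω)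
    (f := fun (k : ℝ) (x : Plane) => starRingEnd ℂ (landauFun β n k x) * u x) ?_
  refine StronglyMeasurable.mul ?_ ((Lp.stronglyMeasurable u).comp_measurable measurable_snd)
  exact (Complex.continuous_conj.comp (continuous_landauFun β n)).stronglyMeasurable

/-- Bessel's inequality in the strip for the extension of `u` by zero; the factor `L` undoes the
normalization of `stripFun`. -/
theorem sum_landauCoeff_le (hβ : 0 < β) (hm : MeasurableSet Ω) {L : ℝ} (hL : 0 < L)
    (hΩL : Ω ⊆ strip L) (u : L2 Ω) (k : ℝ)
    (s : Finset (AddSubgroup.zmultiples (2 * Real.pi / L) × ℕ)) :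
    ∑ p ∈ s, ‖landauCoeff β u p.2 (-(p.1 : ℝ) + k)‖ ^ 2 ≤ L * ‖u‖ ^ 2 := by
  have hu : MemLp (Ω.indicator u) 2 (volume.restrict (strip L)) :=
    ((memLp_indicator_iff_restrict hm).2 (Lp.memLp u)).mono_measure Measure.restrict_le_self
  have hn : ‖hu.toLp _‖ ^ 2 = ‖u‖ ^ 2 := by
    have h1 := norm_toLp_sq (Lp.memLp u)
    rw [Lp.toLp_coeFn] at h1
    rw [norm_toLp_sq, h1]
    have h2 : ∀ x, ‖Ω.indicator u x‖ ^ 2 = Ω.indicator (fun y => ‖u y‖ ^ 2) x := fun x => by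
      by_cases hx : x ∈ Ω <;> simp [hx]
    simp only [h2]
    rw [setIntegral_indicator hm, Set.inter_eq_self_of_subset_right hΩL]
  have hc : ∀ p, inner ℂ (stripFun hβ L k p) (hu.toLp _)
      = (((√L)⁻¹ : ℝ) : ℂ) * landauCoeff β u p.2 (-(p.1 : ℝ) + k) := by
    intro p
    rw [stripFun, inner_smul_left, inner_toLp, Complex.conj_ofReal, landauCoeff]
    congr 1
    have h3 : ∫ x in strip L, starRingEnd ℂ (landauFun β p.2 (-(p.1 : ℝ) + k) x) * hu.toLp _ x
        = ∫ x in strip L,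
          Ω.indicator (fun y => starRingEnd ℂ (landauFun β p.2 (-(p.1 : ℝ) + k) y) * u y) x := by
      refine integral_congr_ae ?_
      filter_upwards [hu.coeFn_toLp] with x hx
      rw [hx]
      by_cases hx : x ∈ Ω <;> simp [hx]
    rw [h3, setIntegral_indicator hm, Set.inter_eq_self_of_subset_right hΩL]
  have hb := (orthonormal_stripFun hβ hL k).sum_inner_products_le (s := s) (hu.toLp _)
  rw [hn] at hb
  have hsq : ∀ p, ‖inner ℂ (stripFun hβ L k p) (hu.toLp _)‖ ^ 2
      = L⁻¹ * ‖landauCoeff β u p.2 (-(p.1 : ℝ) + k)‖ ^ 2 := fun p => by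
    rw [hc, norm_mul, mul_pow, Complex.norm_real, Real.norm_eq_abs, sq_abs, inv_pow,
      Real.sq_sqrt hL.le]
  simp only [hsq] at hb
  rwa [← Finset.mul_sum, inv_mul_le_iff₀ hL] at hb

/-- Bessel's inequality for the generalized Landau eigenfunctions. -/
theorem lintegral_landauCoeff_le (hβ : 0 < β) (hm : MeasurableSet Ω)
    (hΩ : Bornology.IsBounded Ω) (u : L2 Ω) (N : ℕ) :
    ∫⁻ k, ENNReal.ofReal (∑ n ∈ Finset.range N, ‖landauCoeff β u n k‖ ^ 2)
      ≤ ENNReal.ofReal (2 * Real.pi * ‖u‖ ^ 2) := by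
  obtain ⟨C, hC⟩ := exists_bound_of_continuous (f := fun x : Plane => x 0) (by fun_prop) hΩ
  -- The extra `1` makes `L` positive and keeps Ω off the open left edge of the strip.
  set L : ℝ := 2 * (|C| + 1)
  have hL : 0 < L := by positivity
  have hΩL : Ω ⊆ strip L := by
    intro x hx
    have h1 := abs_le.1 ((hC x hx).trans (le_abs_self C))
    have h2 : L / 2 = |C| + 1 := by simp only [L]; ring
    change x 0 ∈ Set.Ioc (-(L / 2)) (L / 2)
    rw [h2]
    constructor <;> linarith [h1.1, h1.2]
  set P : ℝ := 2 * Real.pi / L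
  have hP : 0 < P := by have := Real.pi_pos; positivity
  set F : ℝ → ENNReal := fun k =>
    ENNReal.ofReal (∑ n ∈ Finset.range N, ‖landauCoeff β u n k‖ ^ 2)
  have hF : Measurable F := by
    refine ENNReal.measurable_ofReal.comp (Finset.measurable_sum _ fun n _ => ?_)
    exact ((stronglyMeasurable_landauCoeff β u n).measurable.norm).pow_const 2
  have hbound : ∀ k, ∑' g : AddSubgroup.zmultiples P, F (-(g : ℝ) + k)
      ≤ ENNReal.ofReal (L * ‖u‖ ^ 2) := by
    intro k
    rw [ENNReal.tsum_eq_iSup_sum]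
    refine iSup_le fun s => ?_
    rw [← ENNReal.ofReal_sum_of_nonneg fun g _ => Finset.sum_nonneg fun n _ => sq_nonneg _]
    refine ENNReal.ofReal_le_ofReal ?_
    rw [← Finset.sum_product']
    exact sum_landauCoeff_le hβ hm hL hΩL u k (s ×ˢ Finset.range N)
  -- The line of quasi-momenta is tiled by translates of one period of length `2π/L`. On each coset
  -- the sum is at most `L‖u‖²`, so `L` cancels and `2π‖u‖²` remains.
  calc ∫⁻ k, F k
      = ∑' g : AddSubgroup.zmultiples P, ∫⁻ k in Set.Ioc 0 (0 + P), F (-g +ᵥ k) :=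
        (isAddFundamentalDomain_Ioc hP 0).lintegral_eq_tsum' F
    _ = ∫⁻ k in Set.Ioc 0 (0 + P), ∑' g : AddSubgroup.zmultiples P, F (-(g : ℝ) + k) := by
        rw [lintegral_tsum]
        · rfl
        · exact fun g => (hF.comp (measurable_const_add _)).aemeasurable
    _ ≤ ∫⁻ _ in Set.Ioc 0 (0 + P), ENNReal.ofReal (L * ‖u‖ ^ 2) := lintegral_mono hbound
    _ = ENNReal.ofReal (2 * Real.pi * ‖u‖ ^ 2) := by
        rw [setLIntegral_const, Real.volume_Ioc, ← ENNReal.ofReal_mul (by positivity)]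
        congr 1
        simp only [P]
        field_simp
        ring

theorem integrable_landauCoeff (hβ : 0 < β) (hm : MeasurableSet Ω)
    (hΩ : Bornology.IsBounded Ω) (u : L2 Ω) (N : ℕ) :
    Integrable fun k => ∑ n ∈ Finset.range N, ‖landauCoeff β u n k‖ ^ 2 := by
  refine ⟨(Finset.measurable_sum _ fun n _ =>
    ((stronglyMeasurable_landauCoeff β u n).measurable.norm).pow_const 2).aestronglyMeasurable, ?_⟩
  rw [hasFiniteIntegral_iff_ofReal
    (ae_of_all _ fun k => Finset.sum_nonneg fun n _ => sq_nonneg _)]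
  exact (lintegral_landauCoeff_le hβ hm hΩ u N).trans_lt ENNReal.ofReal_lt_top

theorem integral_landauCoeff_le (hβ : 0 < β) (hm : MeasurableSet Ω)
    (hΩ : Bornology.IsBounded Ω) (u : L2 Ω) (N : ℕ) :
    ∫ k, ∑ n ∈ Finset.range N, ‖landauCoeff β u n k‖ ^ 2 ≤ 2 * Real.pi * ‖u‖ ^ 2 := by
  rw [integral_eq_lintegral_of_nonneg_ae
    (ae_of_all _ fun k => Finset.sum_nonneg fun n _ => sq_nonneg _)
    (integrable_landauCoeff hβ hm hΩ u N).1]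
  refine ENNReal.toReal_le_of_le_ofReal (by positivity) (lintegral_landauCoeff_le hβ hm hΩ u N)

end Bessel

/-! ### Riesz mean and eigenvalue averages -/

section Main

variable {Ω : Set Plane} {β : ℝ} {lam : ℕ → ℝ}

/-- The first Riesz mean is bounded below by that of the first `N` Landau levels. -/
theorem le_rieszMean (hβ : 0 < β) (hm : MeasurableSet Ω) (hΩ : Bornology.IsBounded Ω)
    (hdisc : HasDiscreteSpectrum Ω β) (hlam : IsEigenvalueSequence Ω β lam) {z : ℝ} (hz : 0 ≤ z)
    (N : ℕ) :
    β * (volume Ω).toReal / (2 * Real.pi) * (N * z - β * N ^ 2) ≤ rieszMean lam z := by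
  obtain ⟨I, _, e, μ, he, hμ, hsum, hform⟩ :=
    exists_orthonormal_form_bound hm hΩ hdisc hlam (z := z) (by linarith)
  have hpt : ∀ k : ℝ, ∑ n ∈ Finset.range N, ∫ x in Ω, hermiteDensity β z n (x 1 + k / β)
      ≤ ∑ i, (z - μ i) * ∑ n ∈ Finset.range N, ‖landauCoeff β (e i) n k‖ ^ 2 := by
    intro k
    simp only [Finset.mul_sum]
    rw [Finset.sum_comm]
    refine Finset.sum_le_sum fun n _ => ?_
    rw [← landau_form_eq hm hΩ]
    refine (hform _ _ (isMagneticGradient_landauFun hm hΩ hβ.ne' n k)).trans_eq ?_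
    refine Finset.sum_congr rfl fun i _ => ?_
    rw [← inner_conj_symm, RCLike.norm_conj, inner_toLp]
    rfl
  have hint : ∀ n, Integrable fun k : ℝ => ∫ x in Ω, hermiteDensity β z n (x 1 + k / β) :=
    fun n => (integrable_shifted_density hβ hΩ z n).integral_prod_left
  have h1 := integral_mono (integrable_finsetSum _ fun n _ => hint n)
    (integrable_finsetSum _ fun i _ =>
      (integrable_landauCoeff hβ hm hΩ (e i) N).const_mul (z - μ i)) hpt
  rw [integral_finsetSum _ fun n _ => hint n, integral_finsetSum _ fun i _ =>
      (integrable_landauCoeff hβ hm hΩ (e i) N).const_mul (z - μ i)] at h1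
  simp only [integral_shifted_density hβ hΩ, integral_const_mul] at h1
  have h2 : ∑ i, (z - μ i) * ∫ k, ∑ n ∈ Finset.range N, ‖landauCoeff β (e i) n k‖ ^ 2
      ≤ 2 * Real.pi * rieszMean lam z := by
    rw [hsum, Finset.mul_sum]
    refine Finset.sum_le_sum fun i _ => ?_
    have h3 := integral_landauCoeff_le hβ hm hΩ (e i) N
    rw [he.1 i, one_pow, mul_one] at h3
    calc _ ≤ (z - μ i) * (2 * Real.pi) :=
          mul_le_mul_of_nonneg_left h3 (sub_nonneg.2 (hμ i).le)
      _ = _ := mul_comm _ _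
  -- The first `M` odd numbers add up to `M²`.
  have h4 : ∀ M : ℕ, ∑ n ∈ Finset.range M, (volume Ω).toReal * (β * (z - β * (2 * n + 1)))
      = β * (volume Ω).toReal * (M * z - β * M ^ 2) := by
    intro M
    induction M with
    | zero => simp
    | succ M ih =>
      rw [Finset.sum_range_succ, ih]
      push_cast
      ring
  rw [h4] at h1
  rw [div_mul_eq_mul_div, div_le_iff₀ (by have := Real.pi_pos; positivity)]
  linarith

/-- At `z = lam k` every term of the Riesz mean after index `k` vanishes and no earlier one is
truncated, even when eigenvalues coincide. -/
theorem sum_range_eq (hlam : IsEigenvalueSequence Ω β lam) (k : ℕ) :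
    ∑ j ∈ Finset.range (k + 1), lam j = (k + 1) * lam k - rieszMean lam (lam k) := by
  have h : rieszMean lam (lam k) = ∑ j ∈ Finset.range (k + 1), (lam k - lam j) := by
    rw [rieszMean, tsum_eq_sum (s := Finset.range (k + 1))]
    · refine Finset.sum_congr rfl fun j hj => max_eq_right (sub_nonneg.2 (hlam.monotone ?_))
      exact Nat.lt_succ_iff.1 (Finset.mem_range.1 hj)
    · intro j hj
      refine max_eq_left (sub_nonpos.2 (hlam.monotone ?_))
      exact (not_lt.1 fun h => hj (Finset.mem_range.2 h)).trans' (Nat.le_succ k)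
  rw [h, Finset.sum_sub_distrib]
  simp

theorem remainder_eq_of_le_one {X : ℝ} (hX : 0 < X) (hX1 : X ≤ 1) :
    remainder β X = β * (1 - X) := by
  rcases hX1.lt_or_eq with h | rfl
  · have : ⌊X⌋ = 0 := Int.floor_eq_zero_iff.2 ⟨hX.le, h⟩
    rw [remainder, this]
    field_simp
    push_cast
    ring
  · simp [remainder]

theorem average_le (hβ : 0 < β) (hΩ_open : IsOpen Ω) (hΩ_ne : Ω.Nonempty)
    (hΩ : Bornology.IsBounded Ω) (hdisc : HasDiscreteSpectrum Ω β)
    (hlam : IsEigenvalueSequence Ω β lam) {k : ℕ} (hk : 1 ≤ k) :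
    1 / (k : ℝ) * ∑ j ∈ Finset.range k, lam j
      ≤ 2 * Real.pi * k / (volume Ω).toReal
        + remainder β (2 * Real.pi * k / (β * (volume Ω).toReal)) := by
  have hπ := Real.pi_pos
  have hV : 0 < (volume Ω).toReal :=
    ENNReal.toReal_pos (hΩ_open.measure_pos volume hΩ_ne).ne' hΩ.measure_lt_top.ne
  have hk0 : (0 : ℝ) < k := by exact_mod_cast hk
  set V := (volume Ω).toReal
  set X : ℝ := 2 * Real.pi * k / (β * V) with hX_def
  have hX : 0 < X := by positivity
  obtain ⟨N, hN⟩ : ∃ N : ℕ, (N : ℤ) = ⌊X⌋ := ⟨⌊X⌋.toNat, Int.toNat_of_nonneg (Int.floor_nonneg.2 hX.le)⟩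
  have hN1 : (⌊X⌋ : ℝ) = N := by rw [← hN]; simp
  have hNX : (N : ℝ) ≤ X := hN1 ▸ Int.floor_le X
  have hXN : X < N + 1 := hN1 ▸ Int.lt_floor_add_one X
  obtain ⟨l, rfl⟩ : ∃ l, k = l + 1 := ⟨k - 1, by omega⟩
  set z := lam l
  have hz : 0 ≤ z := hlam.nonneg l
  have h1 := le_rieszMean hβ hΩ_open.measurableSet hΩ hdisc hlam hz N
  have h2 := le_rieszMean hβ hΩ_open.measurableSet hΩ hdisc hlam hz (N + 1)
  have hS := sum_range_eq hlam l
  have hkX : ((l + 1 : ℕ) : ℝ) = β * V / (2 * Real.pi) * X := by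
    rw [hX_def]
    field_simp
  set C : ℝ := β * V / (2 * Real.pi)
  have hC : 0 < C := by positivity
  -- The weights `1 - (X - N)` and `X - N` average `N` and `N + 1` to `X`. The coefficient of `z`
  -- becomes `C X`, the number of eigenvalues in the average, and cancels against the term in `lam
  -- l` of `hS`.
  have hR : C * ((1 - (X - N)) * (N * z - β * N ^ 2)
      + (X - N) * (((N + 1 : ℕ) : ℝ) * z - β * ((N + 1 : ℕ) : ℝ) ^ 2)) ≤ rieszMean lam z := by
    have h3 := mul_le_mul_of_nonneg_left h1 (by linarith : (0 : ℝ) ≤ 1 - (X - N))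
    have h4 := mul_le_mul_of_nonneg_left h2 (by linarith : (0 : ℝ) ≤ X - N)
    change (1 - (X - N)) * (C * _) ≤ _ at h3
    change (X - N) * (C * _) ≤ _ at h4
    linarith
  have hV2 : 2 * Real.pi * ((l + 1 : ℕ) : ℝ) / V = β * X := by
    rw [hX_def]
    field_simp
  rw [hV2, one_div, inv_mul_le_iff₀ hk0, hS, remainder, hN1]
  have h5 : ((l : ℝ) + 1) = C * X := by rw [← hkX]; push_cast; rfl
  rw [hkX, h5]
  have h6 : C * X * (β * X + β / X * (X - N) * (N - X + 1))
      = C * (β * X ^ 2 + β * (X - N) * (N - X + 1)) := by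
    field_simp
  rw [h6]
  push_cast at hR
  linarith

end Main

end MagneticNeumann

theorem mainTheorem6 (Ω : Set MagneticNeumann.Plane) (hΩ_open : IsOpen Ω)
    (hΩ_conn : IsConnected Ω) (hΩ_bdd : Bornology.IsBounded Ω) (β : ℝ) (hβ : 0 < β)
    (hdisc : MagneticNeumann.HasDiscreteSpectrum Ω β)
    (lam : ℕ → ℝ) (hlam : MagneticNeumann.IsEigenvalueSequence Ω β lam) :
    (∀ z : ℝ, 0 ≤ z →
      (Summable fun j : ℕ => max 0 (z - lam j)) ∧
      (volume Ω).toReal / (8 * Real.pi) * z ^ 2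
          - β ^ 2 * (volume Ω).toReal / (2 * Real.pi)
            * MagneticNeumann.fluctuation (z / (2 * β) + 1 / 2) ^ 2
        ≤ MagneticNeumann.rieszMean lam z) ∧
    (∀ k : ℕ, 1 ≤ k →
      1 / (k : ℝ) * ∑ j ∈ Finset.range k, lam j
        ≤ 2 * Real.pi * k / (volume Ω).toReal
          + MagneticNeumann.remainder β (2 * Real.pi * k / (β * (volume Ω).toReal))) ∧
    (∀ X : ℝ, 0 < X →
      0 ≤ MagneticNeumann.remainder β X ∧ MagneticNeumann.remainder β X ≤ β / (4 * X)) ∧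
    (∀ X : ℝ, 0 < X → X ≤ 1 → MagneticNeumann.remainder β X = β * (1 - X)) ∧
    (∀ k : ℕ, 1 ≤ k → (k : ℝ) ≤ β * (volume Ω).toReal / (2 * Real.pi) →
      1 / (k : ℝ) * ∑ j ∈ Finset.range k, lam j ≤ β) := by
  have hπ := Real.pi_pos
  have hV : 0 < (volume Ω).toReal :=
    ENNReal.toReal_pos (hΩ_open.measure_pos volume hΩ_conn.nonempty).ne' hΩ_bdd.measure_lt_top.ne
  refine ⟨fun z hz => ⟨summable_of_ne_finset_zero (hlam.hasFiniteSupport z), ?_⟩,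
    fun k hk => MagneticNeumann.average_le hβ hΩ_open hΩ_conn.nonempty hΩ_bdd hdisc hlam hk,
    fun X hX => ?_, fun X hX hX1 => MagneticNeumann.remainder_eq_of_le_one hX hX1,
    fun k hk hkV => ?_⟩
  · have ha : 0 ≤ z / (2 * β) + 1 / 2 := by positivity
    -- This is an integer nearest to `z/(2β)`, the vertex of `Nz - βN² = z²/(4β) - β(N - z/(2β))²`.
    -- The fluctuation then equals `z/(2β) - N`, so the claimed bound coincides with that of
    -- `le_rieszMean`.
    obtain ⟨N, hN⟩ : ∃ N : ℕ, (N : ℤ) = ⌊z / (2 * β) + 1 / 2⌋ :=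
      ⟨_, Int.toNat_of_nonneg (Int.floor_nonneg.2 ha)⟩
    have h := MagneticNeumann.le_rieszMean hβ hΩ_open.measurableSet hΩ_bdd hdisc hlam hz N
    refine le_trans (le_of_eq ?_) h
    rw [MagneticNeumann.fluctuation, ← hN]
    push_cast
    field_simp
    ring
  · have h0 := Int.floor_le X
    have h1 := Int.lt_floor_add_one X
    have h2 : 0 ≤ X - ⌊X⌋ := by linarith
    have h3 : 0 ≤ (⌊X⌋ : ℝ) - X + 1 := by linarith
    rw [MagneticNeumann.remainder]
    refine ⟨by positivity, ?_⟩
    have h4 : β / (4 * X) = β / X * (1 / 4) := by field_simp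
    rw [h4, mul_assoc]
    refine mul_le_mul_of_nonneg_left ?_ (by positivity)
    -- This is `t(1 - t) ≤ 1/4` for the fractional part `t` of `X`.
    nlinarith [sq_nonneg (X - ⌊X⌋ - 1 / 2)]
  · have hk0 : (0 : ℝ) < k := by exact_mod_cast hk
    have h := MagneticNeumann.average_le hβ hΩ_open hΩ_conn.nonempty hΩ_bdd hdisc hlam hk
    -- With `X` this quotient, the leading term of the average bound is `βX` and the remainder is
    -- `β(1 - X)`, which add up to `β`.
    have hX1 : 2 * Real.pi * k / (β * (volume Ω).toReal) ≤ 1 := by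
      rw [div_le_one (by positivity)]
      rw [le_div_iff₀ (by positivity)] at hkV
      linarith
    rw [MagneticNeumann.remainder_eq_of_le_one (by positivity) hX1] at h
    refine h.trans (le_of_eq ?_)
    field_simp
    ring
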